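/- Let $M,N\ge 0$ be integers and let $t,\alpha_0,\dots,\alpha_M,\gamma_0,\dots,\gamma_M\in\mathbb{C}$, $z_1,\dots,z_N\in\mathbb{C}\setminus\{0\}$. Let $W=\mathbb{C}^2$ and $V_1=\cdots=V_M=\mathbb{C}^2$, each with basis $|0\rangle$ (empty), $|1\rangle$ (occupied). On $W\otimes V_j$, in the ordered basis $|00\rangle,|01\rangle,|10\rangle,|11\rangle$ ($W$ first), put \[ L_{aj}(z)=\begin{pmatrix}1-\gamma_j z&0&0&0\\0&t+\gamma_j z&1&0\\0&(t+1)z&\alpha_j+(1-\alpha_j\gamma_j)z&0\\0&0&0&-t\alpha_j+(1-\alpha_j\gamma_j)z\end{pmatrix}, \] \[ \widetilde L_{aj}(z)=\begin{pmatrix}\alpha_j+(1-\alpha_j\gamma_j)z&0&0&0\\0&t(1-\alpha_j\gamma_j)z-\alpha_j&1&0\\0&(t+1)z&1-\gamma_j z&0\\0&0&0&t\gamma_j z+1\end{pmatrix}. \] Let $T_a(z)=L_{aM}(z^{-1})\cdots L_{a1}(z^{-1})$ and $\widetilde T_a(z)=\widetilde L_{a1}(z)\cdots\widetilde L_{aM}(z)$,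 acting on $W\otimes V_1\otimes\cdots\otimes V_M$, and let $A={}_a\langle 0|T_a|0\rangle_a$, $B={}_a\langle 0|T_a|1\rangle_a$, $\widetilde A={}_a\langle 1|\widetilde T_a|1\rangle_a$, $\widetilde B={}_a\langle 0|\widetilde T_a|1\rangle_a$ (operators on $V_1\otimes\cdots\otimes V_M$). The type I double-row operator is \[ \mathcal B^{\rm I}(z)=\{(1-\alpha_0\gamma_0)tz-\alpha_0\}\,\widetilde B(z)A(z)+\{(1-\alpha_0\gamma_0)z^{-1}+\alpha_0\}\,\widetilde A(z)B(z). \] For integers $1\le x_1<\cdots<x_N\le M$ let $\langle x_1\cdots x_N|$ be the (dual) basis vector with occupied sites exactly $x_1,\dots,x_N$, let $|\overline{x_1}\cdots\overline{x_N}\rangle$ be the basis vector with empty sites exactly $\overline{x_1}<\dots<\overline{x_N}$ (also integers in $\{1,\dots,M\}$), and let $|0^M\rangle$, $\langle 1^M|$ be the all-empty and the all-occupied (dual) basis vectors. Put \[ \Phi^{\rm I}_{M,N}(z|x)=\langle x_1\cdots x_N|\mathcal B^{\rm I}(z_1)\cdots\mathcal B^{\rm I}(z_N)|0^M\rangle,\qquad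 \overline{\Phi}^{\rm I}_{M,N}(z|\overline x)=\langle 1^M|\mathcal B^{\rm I}(z_1)\cdots\mathcal B^{\rm I}(z_N)|\overline{x_1}\cdots\overline{x_N}\rangle . \] For $\lambda_1\ge\cdots\ge\lambda_N\ge0$ the generalized symplectic Schur function is, with $D(z)=\det_{1\le j,k\le N}(z_k^{N-j+1}-z_k^{-N+j-1})$ and $\mu_j=\lambda_j+N-j$, \[ sp_\lambda(\{z\}_N|\{\overline\alpha\}|\{\overline\gamma\})=\frac{\det_{1\le j,k\le N}\bigl(g_{\mu_j}(z_k)-g_{\mu_j}(z_k^{-1})\bigr)}{D(z)}, \] \[ g_\mu(z)=\prod_{j=0}^{\mu}\{\alpha_j+(1-\alpha_j\gamma_j)z\}\prod_{j=\mu+2}^{M}(1-\gamma_jz)\prod_{j=1}^{M}(1-\gamma_jz^{-1}), \] where $\{\overline\alpha\}=\{\alpha_0,\dots,\alpha_M\}$ and $\{\overline\gamma\}=\{\gamma_0,\dots,\gamma_M\}$. \textbf{Theorem.} (a) If $D(z_1,\dots,z_N)\ne0$, then \[ \Phi^{\rm I}_{M,N}(z|x)=\prod_{j=1}^N z_j^{j-1-N}(1+tz_j^2)\prod_{1\le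 j<k\le N}(1+tz_jz_k)(1+tz_jz_k^{-1})\;sp_\lambda(\{z\}_N|\{\overline\alpha\}|\{\overline\gamma\}), \] where $\lambda_j=x_{N-j+1}-N+j-1$ for $j=1,\dots,N$. (b) If $t\neq0$ and $D(tz_1,\dots,tz_N)\ne0$, then \[ \overline\Phi^{\rm I}_{M,N}(z|\overline x)=t^{N(M-N)}\prod_{j=1}^N z_j^{j-1-N}(1+tz_j^2)\prod_{1\le j<k\le N}(1+tz_jz_k)(1+tz_jz_k^{-1})\;sp_{\overline\lambda}(\{tz\}_N|\{-\overline\alpha\}|\{-\overline\gamma\}), \] where $\overline\lambda_j=\overline{x_{N-j+1}}-N+j-1$ for $j=1,\dots,N$, $\{tz\}_N=\{tz_1,\dots,tz_N\}$, and all $\alpha_j,\gamma_j$ ($0\le j\le M$) are replaced by their negatives. -/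

import Mathlib

/-!
Conventions. The state `0 : Fin 2` is "empty", `1 : Fin 2` is "occupied". The space
`W = K²` has basis `|0⟩, |1⟩`, and `V_1 ⊗ ⋯ ⊗ V_M` has the basis of configurations
`Fin M → Fin 2`; the index `k : Fin M` is the site `k + 1`. Operators are given by their
matrices in these bases: `A p q` is the matrix element `⟨p| A |q⟩`. Families of parameters
`α, γ : ℕ → K` are used only at the indices `0, …, M`.
-/

namespace FreeFermion

variable {K : Type*} [Field K]

/-- Basis `|00⟩, |01⟩, |10⟩, |11⟩` of `W ⊗ V` (auxiliary space first), in this order. -/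
def pairIdx (p : Fin 2 × Fin 2) : Fin 4 := finProdFinEquiv p

/-- The type `Γ` `L`-operator on `W ⊗ V`. -/
def LGamma (z t α γ : K) : Matrix (Fin 2 × Fin 2) (Fin 2 × Fin 2) K :=
  Matrix.submatrix
    !![1 - γ * z, 0, 0, 0;
       0, t + γ * z, 1, 0;
       0, (t + 1) * z, α + (1 - α * γ) * z, 0;
       0, 0, 0, -t * α + (1 - α * γ) * z] pairIdx pairIdx

/-- The type `Δ` `L`-operator on `W ⊗ V`. -/
def LDelta (z t α γ : K) : Matrix (Fin 2 × Fin 2) (Fin 2 × Fin 2) K :=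
  Matrix.submatrix
    !![α + (1 - α * γ) * z, 0, 0, 0;
       0, t * (1 - α * γ) * z - α, 1, 0;
       0, (t + 1) * z, 1 - γ * z, 0;
       0, 0, 0, t * γ * z + 1] pairIdx pairIdx

/-- The type I `K`-matrix on `W`. -/
def KI (z t α₀ γ₀ : K) : Matrix (Fin 2) (Fin 2) K :=
  !![(1 - α₀ * γ₀) * t * z - α₀, 0;
     0, (1 - α₀ * γ₀) * z⁻¹ + α₀]

/-- An operator on `W ⊗ V`, acting on `W_a ⊗ (V_1 ⊗ ⋯ ⊗ V_M)` in the auxiliary space and the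
site indexed by `j`, and as the identity on the other sites. -/
def atSite {M : ℕ} (L : Matrix (Fin 2 × Fin 2) (Fin 2 × Fin 2) K) (j : Fin M) :
    Matrix (Fin 2 × (Fin M → Fin 2)) (Fin 2 × (Fin M → Fin 2)) K :=
  Matrix.of fun p q =>
    if ∀ k, k ≠ j → p.2 k = q.2 k then L (p.1, p.2 j) (q.1, q.2 j) else 0

/-- `T_a(z) = L_{aM}(z⁻¹) ⋯ L_{a1}(z⁻¹)`. -/
def monodromy (M : ℕ) (t : K) (α γ : ℕ → K) (z : K) :
    Matrix (Fin 2 × (Fin M → Fin 2)) (Fin 2 × (Fin M → Fin 2)) K :=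
  (List.ofFn fun j : Fin M =>
    atSite (LGamma z⁻¹ t (α (j + 1)) (γ (j + 1))) j).reverse.prod

/-- `T̃_a(z) = L̃_{a1}(z) ⋯ L̃_{aM}(z)`. -/
def monodromyTilde (M : ℕ) (t : K) (α γ : ℕ → K) (z : K) :
    Matrix (Fin 2 × (Fin M → Fin 2)) (Fin 2 × (Fin M → Fin 2)) K :=
  (List.ofFn fun j : Fin M =>
    atSite (LDelta z t (α (j + 1)) (γ (j + 1))) j).prod

/-- The operator `_a⟨a| T |b⟩_a` on `V_1 ⊗ ⋯ ⊗ V_M`. -/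
def auxElem {M : ℕ} (T : Matrix (Fin 2 × (Fin M → Fin 2)) (Fin 2 × (Fin M → Fin 2)) K)
    (a b : Fin 2) : Matrix (Fin M → Fin 2) (Fin M → Fin 2) K :=
  Matrix.of fun p q => T (a, p) (b, q)

/-- The type I double-row operator
`𝓑(z) = B̃(z) ⟨0|K|0⟩ A(z) + Ã(z) ⟨1|K|1⟩ B(z)`, where `A = ⟨0|T|0⟩`, `B = ⟨0|T|1⟩`,
`Ã = ⟨1|T̃|1⟩`, `B̃ = ⟨0|T̃|1⟩`. -/
def doubleRowB (M : ℕ) (t : K) (α γ : ℕ → K) (z : K) :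
    Matrix (Fin M → Fin 2) (Fin M → Fin 2) K :=
  KI z t (α 0) (γ 0) 0 0 •
      (auxElem (monodromyTilde M t α γ z) 0 1 * auxElem (monodromy M t α γ z) 0 0) +
    KI z t (α 0) (γ 0) 1 1 •
      (auxElem (monodromyTilde M t α γ z) 1 1 * auxElem (monodromy M t α γ z) 0 1)

/-- The configuration with particles exactly at the sites `x 0, x 1, …` (sites are numbered
from `1` to `M`). -/
def particles (M : ℕ) {N : ℕ} (x : Fin N → ℕ) : Fin M → Fin 2 :=
  fun k => if ∃ i, x i = (k : ℕ) + 1 then 1 else 0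

/-- The configuration with holes exactly at the sites `x 0, x 1, …`. -/
def holes (M : ℕ) {N : ℕ} (x : Fin N → ℕ) : Fin M → Fin 2 :=
  fun k => if ∃ i, x i = (k : ℕ) + 1 then 0 else 1

/-- The type I wavefunction `⟨x_1 ⋯ x_N| 𝓑(z_1) ⋯ 𝓑(z_N) |0^M⟩`. -/
def waveI (M : ℕ) {N : ℕ} (t : K) (α γ : ℕ → K) (z : Fin N → K) (x : Fin N → ℕ) : K :=
  (List.ofFn fun j => doubleRowB M t α γ (z j)).prod (particles M x) (fun _ => 0)

/-- The type I dual wavefunction `⟨1^M| 𝓑(z_1) ⋯ 𝓑(z_N) |x̄_1 ⋯ x̄_N⟩`. -/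
def dualWaveI (M : ℕ) {N : ℕ} (t : K) (α γ : ℕ → K) (z : Fin N → K) (x : Fin N → ℕ) : K :=
  (List.ofFn fun j => doubleRowB M t α γ (z j)).prod (fun _ => 1) (holes M x)

/-- `g_μ(z|α|γ)`. -/
def gFun (M : ℕ) (α γ : ℕ → K) (μ : ℕ) (z : K) : K :=
  (∏ j ∈ Finset.Icc 0 μ, (α j + (1 - α j * γ j) * z)) *
    (∏ j ∈ Finset.Icc (μ + 2) M, (1 - γ j * z)) *
    ∏ j ∈ Finset.Icc 1 M, (1 - γ j * z⁻¹)

/-- `G_μ({z}|α|γ) = det (g_{μ_j}(z_k) - g_{μ_j}(z_k⁻¹))`. -/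
def GDet (M : ℕ) {N : ℕ} (α γ : ℕ → K) (μ : Fin N → ℕ) (z : Fin N → K) : K :=
  Matrix.det (Matrix.of fun j k => gFun M α γ (μ j) (z k) - gFun M α γ (μ j) (z k)⁻¹)

/-- `det (z_k^{N-j+1} - z_k^{-N+j-1})`, `1 ≤ j, k ≤ N`. -/
def symplecticDenom {N : ℕ} (z : Fin N → K) : K :=
  Matrix.det (Matrix.of fun j k : Fin N =>
    z k ^ ((N : ℤ) - (j : ℤ)) - z k ^ (-(N : ℤ) + (j : ℤ)))

/-- The generalized symplectic Schur function
`sp_λ = G_{λ+δ} / det (z_k^{N-j+1} - z_k^{-N+j-1})`, `δ = (N-1, N-2, …, 0)`. -/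
def spSchur (M : ℕ) {N : ℕ} (α γ : ℕ → K) (lam : Fin N → ℕ) (z : Fin N → K) : K :=
  GDet M α γ (fun j => lam j + (N - 1 - (j : ℕ))) z / symplecticDenom z

/-- `∏_j z_j^{j-1-N} (1 + t z_j²) ∏_{j<k} (1 + t z_j z_k)(1 + t z_j z_k⁻¹)`. -/
def prefactor {N : ℕ} (t : K) (z : Fin N → K) : K :=
  (∏ j : Fin N, z j ^ ((j : ℤ) - (N : ℤ)) * (1 + t * z j ^ 2)) *
    ∏ j : Fin N, ∏ k ∈ Finset.Ioi j, (1 + t * z j * z k) * (1 + t * z j * (z k)⁻¹)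

end FreeFermion

/-! The wavefunctions are free-fermion correlators. Let `field` be F(w) = ∑ₖ (g_k(w) - g_k(w⁻¹))
ψ*ₖ, with ψ*ₖ the Jordan-Wigner creation operators. Two facts tie it to the double-row operator
B(z).

Exchange (`doubleRowB_mul_field`): (z + z⁻¹ - w - w⁻¹) B(z) F(w) = z⁻¹ (1 + tzw)(1 + tzw⁻¹) F(w)
B(z).

Vacua (`doubleRow_mulVec_uniform_zero`, `uniform_one_vecMul_doubleRow`): B(z)|0^M⟩ is proportional
to F(z)|0^M⟩, and ⟨1^M|B(z) to ⟨1^M|F(-tz). Both are stated with denominators cleared.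

Pushing each B to a vacuum and converting it there turns a product of B's into scalars times a
product of F's. The matrix elements of the latter are determinants of amplitudes, by Laplace
expansion. The scalars give the prefactor and, through the Weyl denominator formula of type C
(`symplecticDenom_eq`), the denominator of the symplectic Schur function. In the dual case -tz
becomes tz on negating all α, γ, and the resulting sign is absorbed by the Jordan-Wigner signs of
the holes.

The exchange and vacuum relations are proved by induction on the number of sites. They do not close
on B alone, so each induction carries all four double-row operators. -/

namespace FreeFermion

variable {K : Type*} [Field K]

/-! ### Splitting off the last site -/

/-- The block of an operator on `V_1 ⊗ ⋯ ⊗ V_{M+1}` at the states `v`, `w` of the last site. -/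
def lastBlock {M : ℕ} (A : Matrix (Fin (M + 1) → Fin 2) (Fin (M + 1) → Fin 2) K) (v w : Fin 2) :
    Matrix (Fin M → Fin 2) (Fin M → Fin 2) K :=
  Matrix.of fun p q => A (Fin.snoc (α := fun _ => Fin 2) p v) (Fin.snoc (α := fun _ => Fin 2) q w)

theorem sum_config_succ {R : Type*} [AddCommMonoid R] {M : ℕ} (f : (Fin (M + 1) → Fin 2) → R) :
    ∑ p, f p = ∑ v : Fin 2, ∑ q : Fin M → Fin 2, f (Fin.snoc (α := fun _ => Fin 2) q v) := by
  rw [← Equiv.sum_comp (Fin.snocEquiv fun _ => Fin 2), Fintype.sum_prod_type]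
  rfl

theorem ext_lastBlock {R : Type*} {M : ℕ}
    {A B : Matrix (Fin (M + 1) → Fin 2) (Fin (M + 1) → Fin 2) R}
    (h : ∀ v w, lastBlock A v w = lastBlock B v w) : A = B := by
  ext p q
  have := congrFun (congrFun (h (p (Fin.last M)) (q (Fin.last M))) (Fin.init p)) (Fin.init q)
  simpa [lastBlock] using this

theorem lastBlock_mul {M : ℕ} (A B : Matrix (Fin (M + 1) → Fin 2) (Fin (M + 1) → Fin 2) K)
    (v w : Fin 2) :
    lastBlock (A * B) v w =
      lastBlock A v 0 * lastBlock B 0 w + lastBlock A v 1 * lastBlock B 1 w := by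
  ext p q
  simp [lastBlock, Matrix.mul_apply, sum_config_succ]

theorem lastBlock_add {M : ℕ} (A B : Matrix (Fin (M + 1) → Fin 2) (Fin (M + 1) → Fin 2) K)
    (v w : Fin 2) : lastBlock (A + B) v w = lastBlock A v w + lastBlock B v w := rfl

theorem lastBlock_smul {M : ℕ} (c : K) (A : Matrix (Fin (M + 1) → Fin 2) (Fin (M + 1) → Fin 2) K)
    (v w : Fin 2) : lastBlock (c • A) v w = c • lastBlock A v w := rfl

theorem lastBlock_sub {M : ℕ} (A B : Matrix (Fin (M + 1) → Fin 2) (Fin (M + 1) → Fin 2) K)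
    (v w : Fin 2) : lastBlock (A - B) v w = lastBlock A v w - lastBlock B v w := rfl

theorem lastBlock_neg {M : ℕ} (A : Matrix (Fin (M + 1) → Fin 2) (Fin (M + 1) → Fin 2) K)
    (v w : Fin 2) : lastBlock (-A) v w = -lastBlock A v w := rfl

/-- Extension of an operator on `W ⊗ V_1 ⊗ ⋯ ⊗ V_M` by the identity on `V_{M+1}`. -/
def extendLast {M : ℕ} (A : Matrix (Fin 2 × (Fin M → Fin 2)) (Fin 2 × (Fin M → Fin 2)) K) :
    Matrix (Fin 2 × (Fin (M + 1) → Fin 2)) (Fin 2 × (Fin (M + 1) → Fin 2)) K :=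
  Matrix.of fun p q => if p.2 (Fin.last M) = q.2 (Fin.last M) then
    A (p.1, Fin.init p.2) (q.1, Fin.init q.2) else 0

theorem extendLast_one {M : ℕ} :
    extendLast (1 : Matrix (Fin 2 × (Fin M → Fin 2)) (Fin 2 × (Fin M → Fin 2)) K) = 1 := by
  ext ⟨a, p⟩ ⟨b, q⟩
  induction p using Fin.snocCases with | _ p v
  induction q using Fin.snocCases with | _ q w
  simp only [extendLast, Matrix.of_apply, Fin.snoc_last, Fin.init_snoc, Matrix.one_apply,
    Prod.mk.injEq, Fin.snoc_inj]
  split_ifs <;> simp_all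

theorem extendLast_mul {M : ℕ}
    (A B : Matrix (Fin 2 × (Fin M → Fin 2)) (Fin 2 × (Fin M → Fin 2)) K) :
    extendLast (A * B) = extendLast A * extendLast B := by
  ext ⟨a, p⟩ ⟨b, q⟩
  induction p using Fin.snocCases with | _ p v
  induction q using Fin.snocCases with | _ q w
  simp only [extendLast, Matrix.of_apply, Fin.snoc_last, Fin.init_snoc, Matrix.mul_apply,
    Fintype.sum_prod_type, sum_config_succ]
  fin_cases v <;> fin_cases w <;> simp

theorem extendLast_atSite {M : ℕ} (L : Matrix (Fin 2 × Fin 2) (Fin 2 × Fin 2) K) (j : Fin M) :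
    extendLast (atSite L j) = atSite L j.castSucc := by
  ext ⟨a, p⟩ ⟨b, q⟩
  induction p using Fin.snocCases with | _ p v
  induction q using Fin.snocCases with | _ q w
  simp only [extendLast, atSite, Matrix.of_apply, Fin.snoc_last, Fin.init_snoc,
    Fin.forall_fin_succ', Fin.snoc_castSucc, ne_eq, Fin.castSucc_inj]
  have : Fin.last M ≠ j.castSucc := (Fin.castSucc_lt_last j).ne'
  split_ifs <;> simp_all

/-- `extendLast` as a monoid homomorphism. -/
def extendLastHom (K : Type*) [Field K] (M : ℕ) :
    Matrix (Fin 2 × (Fin M → Fin 2)) (Fin 2 × (Fin M → Fin 2)) K →*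
      Matrix (Fin 2 × (Fin (M + 1) → Fin 2)) (Fin 2 × (Fin (M + 1) → Fin 2)) K where
  toFun := extendLast
  map_one' := extendLast_one
  map_mul' := extendLast_mul

theorem monodromy_succ (M : ℕ) (t : K) (α γ : ℕ → K) (z : K) :
    monodromy (M + 1) t α γ z =
      atSite (LGamma z⁻¹ t (α (M + 1)) (γ (M + 1))) (Fin.last M) *
        extendLast (monodromy M t α γ z) := by
  change _ = _ * extendLastHom K M _
  simp only [monodromy, List.ofFn_succ', List.concat_eq_append, List.reverse_append,
    List.reverse_singleton, List.singleton_append, List.prod_cons, map_list_prod, List.map_reverse,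
    List.map_ofFn, Fin.val_last, Fin.val_castSucc]
  congr 4
  funext j
  exact (extendLast_atSite _ j).symm

theorem monodromyTilde_succ (M : ℕ) (t : K) (α γ : ℕ → K) (z : K) :
    monodromyTilde (M + 1) t α γ z =
      extendLast (monodromyTilde M t α γ z) *
        atSite (LDelta z t (α (M + 1)) (γ (M + 1))) (Fin.last M) := by
  change _ = extendLastHom K M _ * _
  simp only [monodromyTilde, List.ofFn_succ', List.concat_eq_append, List.prod_append,
    List.prod_singleton, map_list_prod, List.map_ofFn, Fin.val_last, Fin.val_castSucc]
  congr 3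
  funext j
  exact (extendLast_atSite _ j).symm

theorem lastBlock_auxElem_atSite_mul {M : ℕ} (L : Matrix (Fin 2 × Fin 2) (Fin 2 × Fin 2) K)
    (A : Matrix (Fin 2 × (Fin M → Fin 2)) (Fin 2 × (Fin M → Fin 2)) K) (a b v w : Fin 2) :
    lastBlock (auxElem (atSite L (Fin.last M) * extendLast A) a b) v w =
      L (a, v) (0, w) • auxElem A 0 b + L (a, v) (1, w) • auxElem A 1 b := by
  ext p q
  have h : ∀ (p' q' : Fin M → Fin 2) (v' w' : Fin 2),
      (∀ k, k ≠ Fin.last M → (Fin.snoc p' v' : Fin (M + 1) → Fin 2) k =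
        (Fin.snoc q' w' : Fin (M + 1) → Fin 2) k) ↔ p' = q' := by
    intro p' q' v' w'
    simp [Fin.forall_fin_succ', funext_iff, Fin.castSucc_ne_last]
  simp only [lastBlock, auxElem, atSite, extendLast, Matrix.mul_apply, Matrix.of_apply, h,
    Fintype.sum_prod_type, sum_config_succ, Fin.snoc_last, Fin.init_snoc, Matrix.add_apply,
    Matrix.smul_apply, smul_eq_mul, Fin.sum_univ_two]
  fin_cases w <;> simp

theorem lastBlock_auxElem_mul_atSite {M : ℕ} (L : Matrix (Fin 2 × Fin 2) (Fin 2 × Fin 2) K)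
    (A : Matrix (Fin 2 × (Fin M → Fin 2)) (Fin 2 × (Fin M → Fin 2)) K) (a b v w : Fin 2) :
    lastBlock (auxElem (extendLast A * atSite L (Fin.last M)) a b) v w =
      L (0, v) (b, w) • auxElem A a 0 + L (1, v) (b, w) • auxElem A a 1 := by
  ext p q
  have h : ∀ (p' q' : Fin M → Fin 2) (v' w' : Fin 2),
      (∀ k, k ≠ Fin.last M → (Fin.snoc p' v' : Fin (M + 1) → Fin 2) k =
        (Fin.snoc q' w' : Fin (M + 1) → Fin 2) k) ↔ p' = q' := by
    intro p' q' v' w'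
    simp [Fin.forall_fin_succ', funext_iff, Fin.castSucc_ne_last]
  simp only [lastBlock, auxElem, atSite, extendLast, Matrix.mul_apply, Matrix.of_apply, h,
    Fintype.sum_prod_type, sum_config_succ, Fin.snoc_last, Fin.init_snoc, Matrix.add_apply,
    Matrix.smul_apply, smul_eq_mul, Fin.sum_univ_two]
  fin_cases v <;> simp [mul_comm]

/-! ### The four double-row operators and their one-site recursion -/

/-- The double-row operators `∑ₖ ⟨k|T̃|b⟩ ⟨k|K|k⟩ ⟨a|T|k⟩`. -/
def doubleRow (M : ℕ) (t : K) (α γ : ℕ → K) (z : K) (a b : Fin 2) :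
    Matrix (Fin M → Fin 2) (Fin M → Fin 2) K :=
  KI z t (α 0) (γ 0) 0 0 •
      (auxElem (monodromyTilde M t α γ z) 0 b * auxElem (monodromy M t α γ z) a 0) +
    KI z t (α 0) (γ 0) 1 1 •
      (auxElem (monodromyTilde M t α γ z) 1 b * auxElem (monodromy M t α γ z) a 1)

theorem doubleRowB_eq (M : ℕ) (t : K) (α γ : ℕ → K) (z : K) :
    doubleRowB M t α γ z = doubleRow M t α γ z 0 1 := rfl

/-- The weight at one site of the double-row operators. -/
def siteWeight (z t α γ : K) (a b c d v w : Fin 2) : K :=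
  ∑ s, LDelta z t α γ (d, v) (b, s) * LGamma z⁻¹ t α γ (a, s) (c, w)

/-- The new site multiplies `T` on the left and `T̃` on the right, so it lies at the end away from
the `K`-matrix. The sum over the state at the `K`-matrix is untouched, and the four operators form a
closed recursion. -/
theorem lastBlock_doubleRow (M : ℕ) (t : K) (α γ : ℕ → K) (z : K) (a b v w : Fin 2) :
    lastBlock (doubleRow (M + 1) t α γ z a b) v w =
      siteWeight z t (α (M + 1)) (γ (M + 1)) a b 0 0 v w • doubleRow M t α γ z 0 0 +
      siteWeight z t (α (M + 1)) (γ (M + 1)) a b 0 1 v w • doubleRow M t α γ z 0 1 +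
      siteWeight z t (α (M + 1)) (γ (M + 1)) a b 1 0 v w • doubleRow M t α γ z 1 0 +
      siteWeight z t (α (M + 1)) (γ (M + 1)) a b 1 1 v w • doubleRow M t α γ z 1 1 := by
  simp only [doubleRow, lastBlock_add, lastBlock_smul, lastBlock_mul, monodromy_succ,
    monodromyTilde_succ, lastBlock_auxElem_atSite_mul, lastBlock_auxElem_mul_atSite, siteWeight,
    Fin.sum_univ_two, mul_add, add_mul, smul_mul_assoc, mul_smul_comm]
  module

/-! ### Jordan-Wigner fermions -/

/-- The sign `(-1)^n`, `n` the number of particles of `p` at the sites before `k`. -/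
def stringSign (K : Type*) [Field K] {M : ℕ} (p : Fin M → Fin 2) (k : Fin M) : K :=
  ∏ j, if j < k ∧ p j = 1 then -1 else 1

/-- The fermion creation operator `∑ₖ uₖ ψ*ₖ` in the Jordan-Wigner representation. -/
def creation {M : ℕ} (u : Fin M → K) : Matrix (Fin M → Fin 2) (Fin M → Fin 2) K :=
  Matrix.of fun p q =>
    ∑ k, if p k = 1 ∧ q = Function.update p k 0 then stringSign K p k * u k else 0

/-- The operator `(-1)^n`, `n` the number of particles. -/
def parity (K : Type*) [Field K] (M : ℕ) : Matrix (Fin M → Fin 2) (Fin M → Fin 2) K :=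
  Matrix.diagonal fun p => ∏ j, if p j = 1 then -1 else 1

theorem lastBlock_parity (M : ℕ) (v w : Fin 2) :
    lastBlock (parity K (M + 1)) v w =
      (if v = w then if v = 1 then -1 else 1 else 0 : K) • parity K M := by
  ext p q
  simp only [lastBlock, parity, Matrix.of_apply, Matrix.diagonal_apply, Fin.snoc_inj,
    Fin.prod_univ_castSucc, Fin.snoc_castSucc, Fin.snoc_last, Matrix.smul_apply, smul_eq_mul]
  split_ifs <;> simp_all

/-- All other sites precede the last one, so creating a particle there carries the full sign
`parity`. -/
theorem lastBlock_creation {M : ℕ} (u : Fin (M + 1) → K) (v w : Fin 2) :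
    lastBlock (creation u) v w =
      (if v = w then 1 else 0 : K) • creation (fun k => u k.castSucc) +
        (if v = 1 ∧ w = 0 then u (Fin.last M) else 0) • parity K M := by
  ext p q
  have h1 : ∀ k : Fin M, (Fin.snoc q w = Function.update (Fin.snoc p v : Fin (M + 1) → Fin 2)
      k.castSucc 0) ↔ q = Function.update p k 0 ∧ w = v := by
    intro k
    rw [← Fin.snoc_update, Fin.snoc_inj]
  have h2 : (Fin.snoc q w = Function.update (Fin.snoc p v : Fin (M + 1) → Fin 2)
      (Fin.last M) 0) ↔ q = p ∧ w = 0 := by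
    rw [Fin.update_snoc_last, Fin.snoc_inj]
  simp only [lastBlock, creation, parity, Matrix.of_apply, Fin.sum_univ_castSucc,
    Fin.snoc_castSucc, Fin.snoc_last, h1, h2, stringSign, Fin.prod_univ_castSucc,
    Fin.castSucc_lt_castSucc_iff, Fin.castSucc_lt_last, true_and, Matrix.add_apply,
    Matrix.smul_apply, Matrix.diagonal_apply, smul_eq_mul, lt_irrefl, false_and, if_false, mul_one,
    fun k : Fin M => (Fin.castSucc_lt_last k).not_gt]
  congr 1
  · by_cases hvw : v = w
    · simp [hvw]
    · simp [hvw, Ne.symm hvw]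
  · by_cases hpq : p = q
    · subst hpq
      by_cases hv : v = 1 <;> by_cases hw : w = 0 <;> simp [hv, hw, mul_comm]
    · simp [hpq, Ne.symm hpq]

/-! ### Explicit site blocks of the double-row operators -/

theorem pairIdx_zero_zero : pairIdx (0, 0) = 0 := rfl
theorem pairIdx_zero_one : pairIdx (0, 1) = 1 := rfl
theorem pairIdx_one_zero : pairIdx (1, 0) = 2 := rfl
theorem pairIdx_one_one : pairIdx (1, 1) = 3 := rfl

theorem LGamma_apply (z t α γ : K) (p q : Fin 2 × Fin 2) :
    LGamma z t α γ p q = !![1 - γ * z, 0, 0, 0;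
       0, t + γ * z, 1, 0;
       0, (t + 1) * z, α + (1 - α * γ) * z, 0;
       0, 0, 0, -t * α + (1 - α * γ) * z] (pairIdx p) (pairIdx q) := rfl

theorem LDelta_apply (z t α γ : K) (p q : Fin 2 × Fin 2) :
    LDelta z t α γ p q = !![α + (1 - α * γ) * z, 0, 0, 0;
       0, t * (1 - α * γ) * z - α, 1, 0;
       0, (t + 1) * z, 1 - γ * z, 0;
       0, 0, 0, t * γ * z + 1] (pairIdx p) (pairIdx q) := rfl

section Blocks

variable (M : ℕ) (t : K) (α γ : ℕ → K) (z : K)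

local notation "aa" => α (M + 1)
local notation "cc" => γ (M + 1)

theorem lastBlock_doubleRow_zero_one (v w : Fin 2) :
    lastBlock (doubleRow (M + 1) t α γ z 0 1) v w =
      !![((1 - cc * z) * (1 - cc * z⁻¹)) • doubleRow M t α γ z 0 1, 0;
        (1 - cc * z⁻¹) • doubleRow M t α γ z 0 0 + (t * cc * z + 1) • doubleRow M t α γ z 1 1,
        ((t * cc * z + 1) * (t + cc * z⁻¹)) • doubleRow M t α γ z 0 1] v w := by
  rw [lastBlock_doubleRow]
  fin_cases v <;> fin_cases w <;>
    simp [siteWeight, LGamma_apply, LDelta_apply, pairIdx_zero_zero, pairIdx_zero_one,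
      pairIdx_one_zero, pairIdx_one_one]

theorem lastBlock_doubleRow_zero_zero (v w : Fin 2) :
    lastBlock (doubleRow (M + 1) t α γ z 0 0) v w =
      !![((aa + (1 - aa * cc) * z) * (1 - cc * z⁻¹)) • doubleRow M t α γ z 0 0 +
          ((t + 1) * z) • doubleRow M t α γ z 1 1,
        ((t + 1) * z * (t + cc * z⁻¹)) • doubleRow M t α γ z 0 1;
        (t * (1 - aa * cc) * z - aa) • doubleRow M t α γ z 1 0,
        ((t * (1 - aa * cc) * z - aa) * (t + cc * z⁻¹)) • doubleRow M t α γ z 0 0] v w := by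
  rw [lastBlock_doubleRow]
  fin_cases v <;> fin_cases w <;>
    simp [siteWeight, LGamma_apply, LDelta_apply, pairIdx_zero_zero, pairIdx_zero_one,
      pairIdx_one_zero, pairIdx_one_one]

theorem lastBlock_doubleRow_one_one (v w : Fin 2) :
    lastBlock (doubleRow (M + 1) t α γ z 1 1) v w =
      !![((1 - cc * z) * (aa + (1 - aa * cc) * z⁻¹)) • doubleRow M t α γ z 1 1,
        ((1 - cc * z) * ((t + 1) * z⁻¹)) • doubleRow M t α γ z 0 1;
        (aa + (1 - aa * cc) * z⁻¹) • doubleRow M t α γ z 1 0,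
        ((t + 1) * z⁻¹) • doubleRow M t α γ z 0 0 +
        ((t * cc * z + 1) * (-t * aa + (1 - aa * cc) * z⁻¹)) • doubleRow M t α γ z 1 1] v w := by
  rw [lastBlock_doubleRow]
  fin_cases v <;> fin_cases w <;>
    simp [siteWeight, LGamma_apply, LDelta_apply, pairIdx_zero_zero, pairIdx_zero_one,
      pairIdx_one_zero, pairIdx_one_one]

theorem lastBlock_doubleRow_one_zero (v w : Fin 2) :
    lastBlock (doubleRow (M + 1) t α γ z 1 0) v w =
      !![((aa + (1 - aa * cc) * z) * (aa + (1 - aa * cc) * z⁻¹)) • doubleRow M t α γ z 1 0,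
        ((aa + (1 - aa * cc) * z) * ((t + 1) * z⁻¹)) • doubleRow M t α γ z 0 0 +
        ((t + 1) * z * (-t * aa + (1 - aa * cc) * z⁻¹)) • doubleRow M t α γ z 1 1;
        0,
        ((t * (1 - aa * cc) * z - aa) * (-t * aa + (1 - aa * cc) * z⁻¹)) •
          doubleRow M t α γ z 1 0] v w := by
  rw [lastBlock_doubleRow]
  fin_cases v <;> fin_cases w <;>
    simp [siteWeight, LGamma_apply, LDelta_apply, pairIdx_zero_zero, pairIdx_zero_one,
      pairIdx_one_zero, pairIdx_one_one]

end Blocks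

/-! ### The field attached to the functions `gFun` -/

theorem creation_smul {M : ℕ} (c : K) (u : Fin M → K) : creation (c • u) = c • creation u := by
  ext p q
  simp only [creation, Matrix.of_apply, Pi.smul_apply, smul_eq_mul, Matrix.smul_apply,
    Finset.mul_sum, mul_ite, mul_zero]
  exact Finset.sum_congr rfl fun k _ => by rw [mul_left_comm]

/-- The amplitudes `g_k(w) - g_k(w⁻¹)`, `0 ≤ k < M`. -/
def amplitude (M : ℕ) (α γ : ℕ → K) (w : K) : Fin M → K :=
  fun k => gFun M α γ k w - gFun M α γ k w⁻¹

/-- `∏_{j=0}^M (α_j + (1 - α_j γ_j) w) ∏_{j=1}^M (1 - γ_j w⁻¹)`. -/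
def edgeProd (M : ℕ) (α γ : ℕ → K) (w : K) : K :=
  (∏ j ∈ Finset.Icc 0 M, (α j + (1 - α j * γ j) * w)) * ∏ j ∈ Finset.Icc 1 M, (1 - γ j * w⁻¹)

theorem edgeProd_zero (α γ : ℕ → K) (w : K) :
    edgeProd 0 α γ w = α 0 + (1 - α 0 * γ 0) * w := by
  simp [edgeProd]

theorem edgeProd_succ (M : ℕ) (α γ : ℕ → K) (w : K) :
    edgeProd (M + 1) α γ w = edgeProd M α γ w *
      ((α (M + 1) + (1 - α (M + 1) * γ (M + 1)) * w) * (1 - γ (M + 1) * w⁻¹)) := by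
  rw [edgeProd, edgeProd, Finset.prod_Icc_succ_top (by lia), Finset.prod_Icc_succ_top (by lia)]
  ring

theorem gFun_succ_of_lt {M k : ℕ} (hk : k < M) (α γ : ℕ → K) (w : K) :
    gFun (M + 1) α γ k w =
      (1 - γ (M + 1) * w) * (1 - γ (M + 1) * w⁻¹) * gFun M α γ k w := by
  rw [gFun, gFun, Finset.prod_Icc_succ_top (by lia : k + 2 ≤ M + 1),
    Finset.prod_Icc_succ_top (by lia : 1 ≤ M + 1)]
  ring

theorem gFun_succ_self (M : ℕ) (α γ : ℕ → K) (w : K) :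
    gFun (M + 1) α γ M w = edgeProd M α γ w * (1 - γ (M + 1) * w⁻¹) := by
  rw [gFun, edgeProd, Finset.prod_Icc_succ_top (by lia : 1 ≤ M + 1),
    Finset.Icc_eq_empty (by lia : ¬ M + 2 ≤ M + 1)]
  simp
  ring

/-- The creation operator `∑ₖ (g_k(w) - g_k(w⁻¹)) ψ*ₖ`. -/
def field (M : ℕ) (α γ : ℕ → K) (w : K) : Matrix (Fin M → Fin 2) (Fin M → Fin 2) K :=
  creation (amplitude M α γ w)

theorem lastBlock_field (M : ℕ) (α γ : ℕ → K) (w : K) (a b : Fin 2) :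
    lastBlock (field (M + 1) α γ w) a b =
      !![((1 - γ (M + 1) * w) * (1 - γ (M + 1) * w⁻¹)) • field M α γ w, 0;
        (edgeProd M α γ w * (1 - γ (M + 1) * w⁻¹) -
          edgeProd M α γ w⁻¹ * (1 - γ (M + 1) * w)) • parity K M,
        ((1 - γ (M + 1) * w) * (1 - γ (M + 1) * w⁻¹)) • field M α γ w] a b := by
  have h : (fun k : Fin M => amplitude (M + 1) α γ w k.castSucc) =
      ((1 - γ (M + 1) * w) * (1 - γ (M + 1) * w⁻¹)) • amplitude M α γ w := by
    funext k
    simp only [amplitude, Fin.val_castSucc, gFun_succ_of_lt k.isLt, Pi.smul_apply, smul_eq_mul,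
      inv_inv]
    ring
  have h' : amplitude (M + 1) α γ w (Fin.last M) =
      edgeProd M α γ w * (1 - γ (M + 1) * w⁻¹) - edgeProd M α γ w⁻¹ * (1 - γ (M + 1) * w) := by
    simp [amplitude, gFun_succ_self]
  rw [field, lastBlock_creation, h, creation_smul, h', ← field]
  fin_cases a <;> fin_cases b <;> simp

theorem doubleRow_zero_sites (t : K) (α γ : ℕ → K) (z : K) (a b : Fin 2) :
    doubleRow 0 t α γ z a b = if a = b then KI z t (α 0) (γ 0) a a • 1 else 0 := by
  ext p q
  obtain rfl : p = q := Subsingleton.elim _ _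
  have h : ∀ r, p = r := fun r => Subsingleton.elim _ _
  fin_cases a <;> fin_cases b <;>
    simp [doubleRow, monodromy, monodromyTilde, auxElem, Matrix.mul_apply, ← h]

theorem field_zero_sites (α γ : ℕ → K) (w : K) : field 0 α γ w = 0 := by
  ext p q
  simp [field, creation]

theorem parity_zero_sites : parity K 0 = 1 := by
  simp [parity]

theorem doubleRow_mul_parity (M : ℕ) (t : K) (α γ : ℕ → K) (z : K) :
    doubleRow M t α γ z 0 0 * parity K M = parity K M * doubleRow M t α γ z 0 0 ∧
    doubleRow M t α γ z 0 1 * parity K M = -(parity K M * doubleRow M t α γ z 0 1) ∧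
    doubleRow M t α γ z 1 0 * parity K M = -(parity K M * doubleRow M t α γ z 1 0) ∧
    doubleRow M t α γ z 1 1 * parity K M = parity K M * doubleRow M t α γ z 1 1 := by
  induction M with
  | zero =>
    simp [doubleRow_zero_sites, parity_zero_sites]
  | succ M ih =>
    obtain ⟨h00, h01, h10, h11⟩ := ih
    refine ⟨?_, ?_, ?_, ?_⟩ <;> refine ext_lastBlock fun v w => ?_ <;>
      fin_cases v <;> fin_cases w <;>
      simp [lastBlock_mul, lastBlock_neg, lastBlock_parity, lastBlock_doubleRow_zero_zero,
        lastBlock_doubleRow_zero_one, lastBlock_doubleRow_one_zero, lastBlock_doubleRow_one_one,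
        h00, h01, h10, h11, Matrix.add_mul, Matrix.mul_add]

/-! ### Exchange relations, by induction on the sites -/

/-- The exchange relations between the double-row operators and `field`. -/
structure Exchange (M : ℕ) (t : K) (α γ : ℕ → K) (z w : K) : Prop where
  zero_one : (z + z⁻¹ - w - w⁻¹) • (doubleRow M t α γ z 0 1 * field M α γ w) =
      (z⁻¹ * (1 + t * z * w) * (1 + t * z * w⁻¹)) • (field M α γ w * doubleRow M t α γ z 0 1)
  zero_zero : (z + z⁻¹ - w - w⁻¹) • (doubleRow M t α γ z 0 0 * field M α γ w) =
      (z⁻¹ * (1 + t * z * w) * (1 + t * z * w⁻¹)) • (field M α γ w * doubleRow M t α γ z 0 0) +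
      ((1 + t) * (edgeProd M α γ w * (w⁻¹ + t * z) - edgeProd M α γ w⁻¹ * (w + t * z))) •
        (parity K M * doubleRow M t α γ z 0 1)
  one_one : (z + z⁻¹ - w - w⁻¹) • (doubleRow M t α γ z 1 1 * field M α γ w) =
      (z⁻¹ * (1 + t * z * w) * (1 + t * z * w⁻¹)) • (field M α γ w * doubleRow M t α γ z 1 1) -
      ((1 + t) * (edgeProd M α γ w * (w⁻¹ - z⁻¹) + edgeProd M α γ w⁻¹ * (z⁻¹ - w))) •
        (parity K M * doubleRow M t α γ z 0 1)
  one_zero : (z + z⁻¹ - w - w⁻¹) • (doubleRow M t α γ z 1 0 * field M α γ w) =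
      (z⁻¹ * (1 + t * z * w) * (1 + t * z * w⁻¹)) • (field M α γ w * doubleRow M t α γ z 1 0) +
      ((1 + t) * (edgeProd M α γ w * (w⁻¹ - z⁻¹) + edgeProd M α γ w⁻¹ * (z⁻¹ - w))) •
        (parity K M * doubleRow M t α γ z 0 0) +
      ((1 + t) * (edgeProd M α γ w * (w⁻¹ + t * z) - edgeProd M α γ w⁻¹ * (w + t * z))) •
        (parity K M * doubleRow M t α γ z 1 1)

section Step

variable {M : ℕ} {t : K} {α γ : ℕ → K} {z w : K}

local notation "aa" => α (M + 1)
local notation "cc" => γ (M + 1)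
local notation "qq" => (1 - γ (M + 1) * w) * (1 - γ (M + 1) * w⁻¹)

/-- Creation on the new site requires the 00 and 11 relations: their `parity` terms cancel those
produced by the off-diagonal block of `field`. The other blocks are multiples of the old relation.
-/
theorem Exchange.succ_zero_one (hz : z ≠ 0) (hw : w ≠ 0) (h : Exchange M t α γ z w) :
    (z + z⁻¹ - w - w⁻¹) • (doubleRow (M + 1) t α γ z 0 1 * field (M + 1) α γ w) =
      (z⁻¹ * (1 + t * z * w) * (1 + t * z * w⁻¹)) • (field (M + 1) α γ w *
        doubleRow (M + 1) t α γ z 0 1) := by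
  obtain ⟨-, p01, -, -⟩ := doubleRow_mul_parity M t α γ z
  refine ext_lastBlock (Fin.forall_fin_two.2 ⟨Fin.forall_fin_two.2 ⟨?_, ?_⟩,
    Fin.forall_fin_two.2 ⟨?_, ?_⟩⟩) <;>
    simp only [lastBlock_mul, lastBlock_smul, lastBlock_field, lastBlock_doubleRow_zero_one] <;>
    simp [Matrix.add_mul, Matrix.mul_add, p01]
  · linear_combination (norm := skip)
      (qq * ((1 - cc * z) * (1 - cc * z⁻¹))) • h.zero_one
    match_scalars <;> field_simp <;> ring
  · linear_combination (norm := skip)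
      (qq * (1 - cc * z⁻¹)) • h.zero_zero +
        (qq * (t * cc * z + 1)) • h.one_one
    match_scalars <;> field_simp <;> ring
  · linear_combination (norm := skip)
      (qq * ((t * cc * z + 1) * (t + cc * z⁻¹))) • h.zero_one
    match_scalars <;> field_simp <;> ring

theorem Exchange.succ_zero_zero (hz : z ≠ 0) (hw : w ≠ 0) (h : Exchange M t α γ z w) :
    (z + z⁻¹ - w - w⁻¹) • (doubleRow (M + 1) t α γ z 0 0 * field (M + 1) α γ w) =
      (z⁻¹ * (1 + t * z * w) * (1 + t * z * w⁻¹)) • (field (M + 1) α γ w *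
        doubleRow (M + 1) t α γ z 0 0) +
      ((1 + t) * (edgeProd (M + 1) α γ w * (w⁻¹ + t * z) -
        edgeProd (M + 1) α γ w⁻¹ * (w + t * z))) •
        (parity K (M + 1) * doubleRow (M + 1) t α γ z 0 1) := by
  obtain ⟨p00, p01, -, -⟩ := doubleRow_mul_parity M t α γ z
  rw [edgeProd_succ, edgeProd_succ, inv_inv]
  refine ext_lastBlock (Fin.forall_fin_two.2 ⟨Fin.forall_fin_two.2 ⟨?_, ?_⟩,
    Fin.forall_fin_two.2 ⟨?_, ?_⟩⟩) <;>
    simp only [lastBlock_mul, lastBlock_smul, lastBlock_field, lastBlock_parity, lastBlock_add,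
      lastBlock_doubleRow_zero_zero, lastBlock_doubleRow_zero_one] <;>
    simp [Matrix.add_mul, Matrix.mul_add, p00, p01]
  · linear_combination (norm := skip)
      (qq * ((aa + (1 - aa * cc) * z) * (1 - cc * z⁻¹))) • h.zero_zero +
        (qq * ((t + 1) * z)) • h.one_one
    match_scalars <;> field_simp <;> ring
  · linear_combination (norm := skip)
      (qq * (((t + 1) * z) * (t + cc * z⁻¹))) • h.zero_one
    match_scalars <;> field_simp <;> ring
  · linear_combination (norm := skip)
      (qq * (t * (1 - aa * cc) * z - aa)) • h.one_zero
    match_scalars <;> field_simp <;> ring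
  · linear_combination (norm := skip)
      (qq * ((t * (1 - aa * cc) * z - aa) * (t + cc * z⁻¹))) • h.zero_zero
    match_scalars <;> field_simp <;> ring

theorem Exchange.succ_one_one (hz : z ≠ 0) (hw : w ≠ 0) (h : Exchange M t α γ z w) :
    (z + z⁻¹ - w - w⁻¹) • (doubleRow (M + 1) t α γ z 1 1 * field (M + 1) α γ w) =
      (z⁻¹ * (1 + t * z * w) * (1 + t * z * w⁻¹)) • (field (M + 1) α γ w *
        doubleRow (M + 1) t α γ z 1 1) -
      ((1 + t) * (edgeProd (M + 1) α γ w * (w⁻¹ - z⁻¹) +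
        edgeProd (M + 1) α γ w⁻¹ * (z⁻¹ - w))) •
        (parity K (M + 1) * doubleRow (M + 1) t α γ z 0 1) := by
  obtain ⟨p00, p01, -, p11⟩ := doubleRow_mul_parity M t α γ z
  rw [edgeProd_succ, edgeProd_succ, inv_inv]
  refine ext_lastBlock (Fin.forall_fin_two.2 ⟨Fin.forall_fin_two.2 ⟨?_, ?_⟩,
    Fin.forall_fin_two.2 ⟨?_, ?_⟩⟩) <;>
    simp only [lastBlock_mul, lastBlock_smul, lastBlock_field, lastBlock_parity, lastBlock_sub,
      lastBlock_doubleRow_one_one, lastBlock_doubleRow_zero_one] <;>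
    simp [Matrix.add_mul, Matrix.mul_add, p00, p01, p11]
  · linear_combination (norm := skip)
      (qq * ((1 - cc * z) * (aa + (1 - aa * cc) * z⁻¹))) • h.one_one
    match_scalars <;> field_simp <;> ring
  · linear_combination (norm := skip)
      (qq * ((1 - cc * z) * ((t + 1) * z⁻¹))) • h.zero_one
    match_scalars <;> field_simp <;> ring
  · linear_combination (norm := skip)
      (qq * (aa + (1 - aa * cc) * z⁻¹)) • h.one_zero
    match_scalars <;> field_simp <;> ring
  · linear_combination (norm := skip)
      (qq * ((t * cc * z + 1) * (-t * aa + (1 - aa * cc) * z⁻¹))) • h.one_one +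
        (qq * ((t + 1) * z⁻¹)) • h.zero_zero
    match_scalars <;> field_simp <;> ring

theorem Exchange.succ_one_zero (hz : z ≠ 0) (hw : w ≠ 0) (h : Exchange M t α γ z w) :
    (z + z⁻¹ - w - w⁻¹) • (doubleRow (M + 1) t α γ z 1 0 * field (M + 1) α γ w) =
      (z⁻¹ * (1 + t * z * w) * (1 + t * z * w⁻¹)) • (field (M + 1) α γ w *
        doubleRow (M + 1) t α γ z 1 0) +
      ((1 + t) * (edgeProd (M + 1) α γ w * (w⁻¹ - z⁻¹) +
        edgeProd (M + 1) α γ w⁻¹ * (z⁻¹ - w))) •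
        (parity K (M + 1) * doubleRow (M + 1) t α γ z 0 0) +
      ((1 + t) * (edgeProd (M + 1) α γ w * (w⁻¹ + t * z) -
        edgeProd (M + 1) α γ w⁻¹ * (w + t * z))) •
        (parity K (M + 1) * doubleRow (M + 1) t α γ z 1 1) := by
  obtain ⟨p00, -, p10, p11⟩ := doubleRow_mul_parity M t α γ z
  rw [edgeProd_succ, edgeProd_succ, inv_inv]
  refine ext_lastBlock (Fin.forall_fin_two.2 ⟨Fin.forall_fin_two.2 ⟨?_, ?_⟩,
    Fin.forall_fin_two.2 ⟨?_, ?_⟩⟩) <;>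
    simp only [lastBlock_mul, lastBlock_smul, lastBlock_field, lastBlock_parity, lastBlock_add,
      lastBlock_doubleRow_one_zero, lastBlock_doubleRow_zero_zero, lastBlock_doubleRow_one_one] <;>
    simp [Matrix.add_mul, Matrix.mul_add, p00, p10, p11]
  · linear_combination (norm := skip)
      (qq * ((aa + (1 - aa * cc) * z) * (aa + (1 - aa * cc) * z⁻¹))) • h.one_zero
    match_scalars <;> field_simp <;> ring
  · linear_combination (norm := skip)
      (qq * ((aa + (1 - aa * cc) * z) * ((t + 1) * z⁻¹))) • h.zero_zero +
        (qq * (((t + 1) * z) * (-t * aa + (1 - aa * cc) * z⁻¹))) • h.one_one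
    match_scalars <;> field_simp <;> ring
  -- No induction hypothesis is needed: the block of the 10 operator is zero here, so only multiples
  -- of `parity` times the 10 operator occur, and a scalar identity remains.
  · match_scalars
    field_simp
    ring
  · linear_combination (norm := skip)
      (qq * ((t * (1 - aa * cc) * z - aa) * (-t * aa + (1 - aa * cc) * z⁻¹))) • h.one_zero
    match_scalars <;> field_simp <;> ring

end Step

theorem exchange (M : ℕ) (t : K) (α γ : ℕ → K) {z w : K} (hz : z ≠ 0) (hw : w ≠ 0) :
    Exchange M t α γ z w := by
  induction M with
  | zero =>
    constructor <;>
      simp only [doubleRow_zero_sites, field_zero_sites, edgeProd_zero, parity_zero_sites, KI] <;>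
      simp
    -- Without sites the field vanishes and only `one_zero` has content: its two inhomogeneous terms
    -- cancel because of the entries of the `K`-matrix.
    match_scalars
    field_simp
    ring
  | succ M ih =>
    exact ⟨ih.succ_zero_one hz hw, ih.succ_zero_zero hz hw, ih.succ_one_one hz hw,
      ih.succ_one_zero hz hw⟩

/-! ### Action on the empty and the full state -/

/-- The component of a vector of `V_1 ⊗ ⋯ ⊗ V_{M+1}` at the state `v` of the last site. -/
def lastPart {M : ℕ} (f : (Fin (M + 1) → Fin 2) → K) (v : Fin 2) : (Fin M → Fin 2) → K :=
  fun p => f (Fin.snoc (α := fun _ => Fin 2) p v)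

theorem ext_lastPart {R : Type*} {M : ℕ} {f g : (Fin (M + 1) → Fin 2) → R}
    (h0 : lastPart f 0 = lastPart g 0) (h1 : lastPart f 1 = lastPart g 1) : f = g := by
  funext p
  have h : ∀ v, lastPart f v = lastPart g v := Fin.forall_fin_two.2 ⟨h0, h1⟩
  have := congrFun (h (p (Fin.last M))) (Fin.init p)
  simpa [lastPart] using this

theorem lastPart_smul {M : ℕ} (c : K) (f : (Fin (M + 1) → Fin 2) → K) (v : Fin 2) :
    lastPart (c • f) v = c • lastPart f v := rfl

theorem lastPart_zero {M : ℕ} (v : Fin 2) :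
    lastPart (0 : (Fin (M + 1) → Fin 2) → K) v = 0 := rfl

theorem lastPart_mulVec {M : ℕ} (A : Matrix (Fin (M + 1) → Fin 2) (Fin (M + 1) → Fin 2) K)
    (f : (Fin (M + 1) → Fin 2) → K) (v : Fin 2) :
    lastPart (A.mulVec f) v =
      (lastBlock A v 0).mulVec (lastPart f 0) + (lastBlock A v 1).mulVec (lastPart f 1) := by
  funext p
  simp [lastPart, lastBlock, Matrix.mulVec, dotProduct, sum_config_succ]

theorem lastPart_vecMul {M : ℕ} (A : Matrix (Fin (M + 1) → Fin 2) (Fin (M + 1) → Fin 2) K)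
    (f : (Fin (M + 1) → Fin 2) → K) (v : Fin 2) :
    lastPart (Matrix.vecMul f A) v =
      Matrix.vecMul (lastPart f 0) (lastBlock A 0 v) +
        Matrix.vecMul (lastPart f 1) (lastBlock A 1 v) := by
  funext p
  simp [lastPart, lastBlock, Matrix.vecMul, dotProduct, sum_config_succ]

/-- The vector with all sites in the state `s`. -/
def uniform (K : Type*) [Field K] (M : ℕ) (s : Fin 2) : (Fin M → Fin 2) → K :=
  Pi.single (fun _ => s) 1

theorem lastPart_uniform (M : ℕ) (s v : Fin 2) :
    lastPart (uniform K (M + 1) s) v = (if v = s then 1 else 0 : K) • uniform K M s := by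
  funext p
  have h : (fun _ => s : Fin (M + 1) → Fin 2) = Fin.snoc (α := fun _ => Fin 2) (fun _ => s) s := by
    funext k
    induction k using Fin.lastCases <;> simp
  simp only [lastPart, uniform, h, Pi.single_apply, Fin.snoc_inj, Pi.smul_apply, smul_eq_mul]
  split_ifs <;> simp_all

theorem parity_mulVec_uniform_zero (M : ℕ) :
    (parity K M).mulVec (uniform K M 0) = uniform K M 0 := by
  funext p
  simp only [parity, uniform, Matrix.mulVec_diagonal, Pi.single_apply]
  split_ifs with h <;> simp [h]

theorem uniform_one_vecMul_parity (M : ℕ) :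
    Matrix.vecMul (uniform K M 1) (parity K M) = (-1 : K) ^ M • uniform K M 1 := by
  funext p
  simp only [parity, uniform, Matrix.vecMul_diagonal, Pi.single_apply, Pi.smul_apply]
  split_ifs with h <;> simp [h]

/-- The system is triangular: the 10 operator kills the vacuum, the 11 and 00 operators act
diagonally, and 01 creates on the new site through 00 and 11. The factor `z - z⁻¹` avoids division
at z = ±1. -/
theorem doubleRow_mulVec_uniform_zero (M : ℕ) (t : K) (α γ : ℕ → K) {z : K} (hz : z ≠ 0) :
    (doubleRow M t α γ z 1 0).mulVec (uniform K M 0) = 0 ∧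
    (doubleRow M t α γ z 1 1).mulVec (uniform K M 0) = edgeProd M α γ z⁻¹ • uniform K M 0 ∧
    (z - z⁻¹) • (doubleRow M t α γ z 0 0).mulVec (uniform K M 0) =
      ((z⁻¹ + t * z) * edgeProd M α γ z - (t + 1) * z * edgeProd M α γ z⁻¹) • uniform K M 0 ∧
    (z - z⁻¹) • (doubleRow M t α γ z 0 1).mulVec (uniform K M 0) =
      (z⁻¹ + t * z) • (field M α γ z).mulVec (uniform K M 0) := by
  induction M with
  | zero =>
    refine ⟨?_, ?_, ?_, ?_⟩ <;>
      simp only [doubleRow_zero_sites, field_zero_sites, edgeProd_zero, KI] <;>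
      simp [Matrix.smul_mulVec]
    · module
    · match_scalars
      field_simp
      ring
  | succ M ih =>
    obtain ⟨h10, h11, h00, h01⟩ := ih
    rw [edgeProd_succ, edgeProd_succ, inv_inv]
    refine ⟨?_, ?_, ?_, ?_⟩ <;> apply ext_lastPart <;>
      simp only [lastPart_smul, lastPart_zero, lastPart_mulVec, lastPart_uniform, lastBlock_field,
        lastBlock_doubleRow_zero_zero, lastBlock_doubleRow_zero_one,
        lastBlock_doubleRow_one_zero, lastBlock_doubleRow_one_one] <;>
      simp [Matrix.smul_mulVec, Matrix.add_mulVec, h10, h11, parity_mulVec_uniform_zero]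
    · module
    · linear_combination (norm := skip) ((α (M + 1) + (1 - α (M + 1) * γ (M + 1)) * z) *
        (1 - γ (M + 1) * z⁻¹)) • h00
      match_scalars <;> field_simp <;> ring
    · linear_combination (norm := skip) ((1 - γ (M + 1) * z) * (1 - γ (M + 1) * z⁻¹)) • h01
      match_scalars <;> field_simp <;> ring
    · linear_combination (norm := skip) (1 - γ (M + 1) * z⁻¹) • h00
      match_scalars <;> field_simp <;> ring

/-- The point `-(t * z)` is read off from the 00 operator: its weight on an occupied site, `(t(1 -
αγ)z - α)(t + γz⁻¹)`, is `-t` times the site factor of `edgeProd` at `-(t * z)`. -/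
theorem uniform_one_vecMul_doubleRow (M : ℕ) {t : K} (α γ : ℕ → K) {z : K} (ht : t ≠ 0)
    (hz : z ≠ 0) :
    Matrix.vecMul (uniform K M 1) (doubleRow M t α γ z 1 0) = 0 ∧
    Matrix.vecMul (uniform K M 1) (doubleRow M t α γ z 0 0) =
      (-(-t) ^ M * edgeProd M α γ (-(t * z))) • uniform K M 1 ∧
    ((t * z)⁻¹ - t * z) • Matrix.vecMul (uniform K M 1) (doubleRow M t α γ z 1 1) =
      ((-t) ^ M * (-(t * z + z⁻¹) * edgeProd M α γ (-(t * z))⁻¹ +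
        (t + 1) * (t * z)⁻¹ * edgeProd M α γ (-(t * z)))) • uniform K M 1 ∧
    (t * ((t * z)⁻¹ - t * z)) • Matrix.vecMul (uniform K M 1) (doubleRow M t α γ z 0 1) =
      (t ^ M * (z⁻¹ + t * z)) • Matrix.vecMul (uniform K M 1) (field M α γ (-(t * z))) := by
  induction M with
  | zero =>
    refine ⟨?_, ?_, ?_, ?_⟩ <;>
      simp only [doubleRow_zero_sites, field_zero_sites, edgeProd_zero, KI] <;>
      simp [Matrix.vecMul_smul]
    · module
    · match_scalars
      field_simp
      ring
  | succ M ih =>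
    obtain ⟨h10, h00, h11, h01⟩ := ih
    rw [edgeProd_succ, edgeProd_succ, inv_inv]
    refine ⟨?_, ?_, ?_, ?_⟩ <;> apply ext_lastPart <;>
      simp only [lastPart_smul, lastPart_zero, lastPart_vecMul, lastPart_uniform, lastBlock_field,
        lastBlock_doubleRow_zero_zero, lastBlock_doubleRow_zero_one,
        lastBlock_doubleRow_one_zero, lastBlock_doubleRow_one_one] <;>
      simp [Matrix.vecMul_smul, Matrix.vecMul_add, h10, h00, uniform_one_vecMul_parity]
    · match_scalars
      field_simp
      ring
    · linear_combination (norm := skip) ((t * γ (M + 1) * z + 1) *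
        (-t * α (M + 1) + (1 - α (M + 1) * γ (M + 1)) * z⁻¹)) • h11
      match_scalars <;> field_simp <;> ring
    · linear_combination (norm := skip) (t * (t * γ (M + 1) * z + 1)) • h11
      match_scalars <;> field_simp <;> ring
    · linear_combination (norm := skip) ((t * γ (M + 1) * z + 1) * (t + γ (M + 1) * z⁻¹)) • h01
      match_scalars <;> field_simp <;> ring

/-! ### Matrix elements of products of creation operators as determinants -/

/-- The configuration in the state `s` exactly at the positions `y i`, and in the state `s'`
elsewhere. -/
def configAt {M N : ℕ} (s s' : Fin 2) (y : Fin N → Fin M) : Fin M → Fin 2 :=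
  fun k => if ∃ i, y i = k then s else s'

theorem configAt_zero {M : ℕ} (s s' : Fin 2) (y : Fin 0 → Fin M) :
    configAt s s' y = fun _ => s' := by
  funext k
  simp [configAt]

theorem configAt_apply {M N : ℕ} (s s' : Fin 2) (y : Fin N → Fin M) (i : Fin N) :
    configAt s s' y (y i) = s :=
  if_pos ⟨i, rfl⟩

theorem configAt_eq_iff {M N : ℕ} {s s' : Fin 2} (h : s ≠ s') (y : Fin N → Fin M) (k : Fin M) :
    configAt s s' y k = s ↔ k ∈ Set.range y := by
  simp only [configAt, Set.mem_range]
  split_ifs with hk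
  · simpa using hk
  · simpa [h.symm] using hk

theorem update_configAt {M N : ℕ} (s s' : Fin 2) {y : Fin (N + 1) → Fin M}
    (hy : Function.Injective y) (i : Fin (N + 1)) :
    Function.update (configAt s s' y) (y i) s' = configAt s s' (fun j => y (i.succAbove j)) := by
  funext k
  by_cases hk : k = y i
  · subst hk
    simp [configAt, hy.eq_iff, Fin.succAbove_ne]
  · rw [Function.update_of_ne hk]
    have : (∃ j, y j = k) ↔ ∃ j, y (i.succAbove j) = k := by
      rw [Fin.exists_iff_succAbove (p := i)]
      simp [Ne.symm hk]
    simp only [configAt, this]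

theorem prod_lt_neg_one {n : ℕ} (i : Fin n) :
    ∏ j : Fin n, (if j < i then -1 else 1 : K) = (-1) ^ (i : ℕ) := by
  have h : (Finset.univ.filter fun j : Fin n => j < i) = Finset.Iio i := by
    ext j
    simp
  rw [Finset.prod_ite, Finset.prod_const, Finset.prod_const_one, mul_one, h, Fin.card_Iio]

theorem prod_lt_of_strictMono {M N : ℕ} {y : Fin N → Fin M} (hy : StrictMono y) (i : Fin N) :
    ∏ j, (if j < y i ∧ j ∈ Set.range y then -1 else 1 : K) = (-1) ^ (i : ℕ) := by
  rw [← Fintype.prod_of_injective y hy.injective (fun j => if j < i then (-1 : K) else 1)]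
  · exact prod_lt_neg_one i
  · intro k hk
    rw [if_neg fun h => hk h.2]
  · intro j
    simp [hy.lt_iff_lt]

theorem stringSign_configAt_one {M N : ℕ} {y : Fin N → Fin M} (hy : StrictMono y) (i : Fin N) :
    stringSign K (configAt 1 0 y) (y i) = (-1) ^ (i : ℕ) := by
  simp only [stringSign, configAt_eq_iff one_ne_zero]
  exact prod_lt_of_strictMono hy i

theorem stringSign_update {M : ℕ} (p : Fin M → Fin 2) (k : Fin M) (s : Fin 2) :
    stringSign K (Function.update p k s) k = stringSign K p k := by
  refine Finset.prod_congr rfl fun j _ => ?_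
  by_cases hj : j < k
  · rw [Function.update_of_ne hj.ne]
  · simp [hj]

/-- Among the sites before the `i`-th hole, exactly `i` are holes, so the particles there number `y
i - i`. -/
theorem stringSign_configAt_zero {M N : ℕ} {y : Fin N → Fin M} (hy : StrictMono y) (i : Fin N) :
    stringSign K (configAt 0 1 y) (y i) = (-1) ^ (i : ℕ) * (-1) ^ (y i : ℕ) := by
  rw [← prod_lt_of_strictMono hy i, ← prod_lt_neg_one (y i), ← Finset.prod_mul_distrib]
  refine Finset.prod_congr rfl fun j _ => ?_
  have h1 : configAt 0 1 y j = 1 ↔ ¬ j ∈ Set.range y := by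
    rw [← configAt_eq_iff zero_ne_one y j]
    lia
  by_cases hj : j < y i <;> by_cases hr : j ∈ Set.range y <;> simp only [h1, hj, hr] <;> simp

theorem creation_mulVec_configAt {M N : ℕ} (u : Fin M → K) (f : (Fin M → Fin 2) → K)
    {y : Fin (N + 1) → Fin M} (hy : StrictMono y) :
    (creation u).mulVec f (configAt 1 0 y) =
      ∑ i : Fin (N + 1), (-1) ^ (i : ℕ) * u (y i) * f (configAt 1 0 fun j => y (i.succAbove j)) := by
  simp only [Matrix.mulVec, dotProduct, creation, Matrix.of_apply, Finset.sum_mul]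
  rw [Finset.sum_comm]
  symm
  refine Fintype.sum_of_injective y hy.injective _ _ ?_ ?_
  · intro k hk
    simp [configAt_eq_iff one_ne_zero, hk]
  · intro i
    simp [configAt_apply, stringSign_configAt_one hy, update_configAt 1 0 hy.injective]

theorem vecMul_creation_configAt {M N : ℕ} (u : Fin M → K) (f : (Fin M → Fin 2) → K)
    {y : Fin (N + 1) → Fin M} (hy : StrictMono y) :
    Matrix.vecMul f (creation u) (configAt 0 1 y) =
      ∑ i : Fin (N + 1), (-1) ^ (i : ℕ) * ((-1) ^ (y i : ℕ) * u (y i)) *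
        f (configAt 0 1 fun j => y (i.succAbove j)) := by
  have h : ∀ (p h : Fin M → Fin 2) (k : Fin M),
      (p k = 1 ∧ h = Function.update p k 0) ↔ (h k = 0 ∧ p = Function.update h k 1) := by
    intro p h k
    constructor
    · rintro ⟨hp, rfl⟩
      simp [← hp]
    · rintro ⟨hp, rfl⟩
      simp [← hp]
  simp only [Matrix.vecMul, dotProduct, creation, Matrix.of_apply, Finset.mul_sum, h]
  rw [Finset.sum_comm]
  symm
  refine Fintype.sum_of_injective y hy.injective _ _ ?_ ?_
  · intro k hk
    simp [configAt_eq_iff zero_ne_one, hk]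
  · intro i
    have hs := stringSign_update (K := K) (configAt 0 1 y) (y i) 1
    rw [update_configAt 0 1 hy.injective, stringSign_configAt_zero hy] at hs
    simp [configAt_apply, update_configAt 0 1 hy.injective, hs]
    ring

/-- The leftmost operator may have created any one of the particles, with alternating sign: this is
Laplace expansion along column 0. -/
theorem prod_creation_mulVec {M N : ℕ} (u : Fin N → Fin M → K) {y : Fin N → Fin M}
    (hy : StrictMono y) :
    ((List.ofFn fun k => creation (u k)).prod.mulVec (uniform K M 0)) (configAt 1 0 y) =
      Matrix.det (Matrix.of fun i k => u k (y i)) := by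
  induction N with
  | zero => simp [configAt_zero, uniform]
  | succ N ih =>
    rw [List.ofFn_succ, List.prod_cons, ← Matrix.mulVec_mulVec, creation_mulVec_configAt _ _ hy,
      Matrix.det_succ_column_zero]
    refine Finset.sum_congr rfl fun i _ => ?_
    exact congrArg (_ * ·) (ih (fun k => u k.succ) (hy.comp (Fin.strictMono_succAbove i)))

theorem vecMul_prod_creation {M N : ℕ} (u : Fin N → Fin M → K) {y : Fin N → Fin M}
    (hy : StrictMono y) :
    (Matrix.vecMul (uniform K M 1) (List.ofFn fun k => creation (u k)).reverse.prod)
        (configAt 0 1 y) =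
      Matrix.det (Matrix.of fun i k => (-1) ^ (y i : ℕ) * u k (y i)) := by
  induction N with
  | zero => simp [configAt_zero, uniform]
  | succ N ih =>
    rw [List.ofFn_succ, List.reverse_cons, List.prod_append, List.prod_singleton,
      ← Matrix.vecMul_vecMul, vecMul_creation_configAt _ _ hy, Matrix.det_succ_column_zero]
    refine Finset.sum_congr rfl fun i _ => ?_
    exact congrArg (_ * ·) (ih (fun k => u k.succ) (hy.comp (Fin.strictMono_succAbove i)))

/-! ### Turning products of B's into products of fields -/

theorem prod_pairs_succ {N : ℕ} (f : Fin (N + 1) → Fin (N + 1) → K) :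
    ∏ j, ∏ k ∈ Finset.Ioi j, f j k =
      (∏ k : Fin N, f 0 k.succ) * ∏ j : Fin N, ∏ k ∈ Finset.Ioi j, f j.succ k.succ := by
  rw [Fin.prod_univ_succ, Fin.prod_Ioi_zero]
  simp only [Fin.prod_Ioi_succ]

theorem doubleRowB_mul_field (M : ℕ) (t : K) (α γ : ℕ → K) {z w : K} (hz : z ≠ 0) (hw : w ≠ 0) :
    (z + z⁻¹ - w - w⁻¹) • (doubleRowB M t α γ z * field M α γ w) =
      (z⁻¹ * (1 + t * z * w) * (1 + t * z * w⁻¹)) • (field M α γ w * doubleRowB M t α γ z) :=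
  (exchange M t α γ hz hw).zero_one

theorem doubleRowB_mul_prod_field {M N : ℕ} (t : K) (α γ : ℕ → K) {z : K} (hz : z ≠ 0)
    {w : Fin N → K} (hw : ∀ k, w k ≠ 0) :
    (∏ k, (z + z⁻¹ - w k - (w k)⁻¹)) •
        (doubleRowB M t α γ z * (List.ofFn fun k => field M α γ (w k)).reverse.prod) =
      (∏ k, z⁻¹ * (1 + t * z * w k) * (1 + t * z * (w k)⁻¹)) •
        ((List.ofFn fun k => field M α γ (w k)).reverse.prod * doubleRowB M t α γ z) := by
  induction N with
  | zero => simp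
  | succ N ih =>
    have h0 := doubleRowB_mul_field M t α γ hz (hw 0)
    have h1 := ih fun k => hw k.succ
    rw [List.ofFn_succ, List.reverse_cons, List.prod_append, List.prod_singleton,
      Fin.prod_univ_succ, Fin.prod_univ_succ]
    set R := (List.ofFn fun k : Fin N => field M α γ (w k.succ)).reverse.prod
    rw [← mul_assoc, mul_smul, ← smul_mul_assoc, h1, smul_mul_assoc, mul_assoc, smul_comm,
      ← mul_smul_comm, h0, mul_smul_comm, smul_smul, mul_comm (∏ _, _), mul_assoc R]

theorem field_mul_prod_doubleRowB {M N : ℕ} (t : K) (α γ : ℕ → K) {w : K} (hw : w ≠ 0)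
    {z : Fin N → K} (hz : ∀ k, z k ≠ 0) :
    (∏ k, (z k)⁻¹ * (1 + t * z k * w) * (1 + t * z k * w⁻¹)) •
        (field M α γ w * (List.ofFn fun k => doubleRowB M t α γ (z k)).prod) =
      (∏ k, (z k + (z k)⁻¹ - w - w⁻¹)) •
        ((List.ofFn fun k => doubleRowB M t α γ (z k)).prod * field M α γ w) := by
  induction N with
  | zero => simp
  | succ N ih =>
    have h0 := doubleRowB_mul_field M t α γ (hz 0) hw
    have h1 := ih fun k => hz k.succ
    rw [List.ofFn_succ, List.prod_cons, Fin.prod_univ_succ, Fin.prod_univ_succ]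
    set R := (List.ofFn fun k : Fin N => doubleRowB M t α γ (z k.succ)).prod
    rw [← mul_assoc, mul_comm, mul_smul, ← smul_mul_assoc, ← h0, smul_mul_assoc, mul_assoc,
      smul_comm, ← mul_smul_comm, h1, mul_smul_comm, smul_smul, mul_assoc]

theorem prod_doubleRowB_mulVec {M N : ℕ} (t : K) (α γ : ℕ → K) {z : Fin N → K}
    (hz : ∀ k, z k ≠ 0) :
    ((∏ k, (z k - (z k)⁻¹)) *
        ∏ j, ∏ k ∈ Finset.Ioi j, (z j + (z j)⁻¹ - z k - (z k)⁻¹)) •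
        (List.ofFn fun k => doubleRowB M t α γ (z k)).prod.mulVec (uniform K M 0) =
      ((∏ k, ((z k)⁻¹ + t * z k)) * ∏ j, ∏ k ∈ Finset.Ioi j,
        (z j)⁻¹ * (1 + t * z j * z k) * (1 + t * z j * (z k)⁻¹)) •
        (List.ofFn fun k => field M α γ (z k)).reverse.prod.mulVec (uniform K M 0) := by
  induction N with
  | zero => simp
  | succ N ih =>
    have h0 := (doubleRow_mulVec_uniform_zero M t α γ (hz 0)).2.2.2
    rw [← doubleRowB_eq] at h0
    have h1 := ih fun k => hz k.succ
    have h2 := doubleRowB_mul_prod_field (M := M) t α γ (hz 0) fun k : Fin N => hz k.succ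
    rw [prod_pairs_succ fun j k => z j + (z j)⁻¹ - z k - (z k)⁻¹,
      prod_pairs_succ fun j k => (z j)⁻¹ * (1 + t * z j * z k) * (1 + t * z j * (z k)⁻¹),
      List.ofFn_succ, List.ofFn_succ, List.reverse_cons, List.prod_append, List.prod_singleton,
      List.prod_cons, Fin.prod_univ_succ, Fin.prod_univ_succ]
    set R := (List.ofFn fun k : Fin N => field M α γ (z k.succ)).reverse.prod
    set Q := (List.ofFn fun k : Fin N => doubleRowB M t α γ (z k.succ)).prod
    set B := doubleRowB M t α γ (z 0)
    set d := ∏ k : Fin N, (z 0 + (z 0)⁻¹ - z k.succ - (z k.succ)⁻¹)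
    set s := ∏ k : Fin N, (z 0)⁻¹ * (1 + t * z 0 * z k.succ) * (1 + t * z 0 * (z k.succ)⁻¹)
    set a := (∏ k : Fin N, (z k.succ - (z k.succ)⁻¹))
    set b := (∏ k : Fin N, ((z k.succ)⁻¹ + t * z k.succ))
    -- Rewrite the inner B's as fields (`h3`), move the outermost B through these fields (`h4`),
    -- then convert it on the vacuum (`h5`).
    have h3 := congrArg (fun f => ((z 0 - (z 0)⁻¹) * d) • B.mulVec f) h1
    have h4 := congrArg (fun A : Matrix _ _ K => (z 0 - (z 0)⁻¹) • A.mulVec (uniform K M 0)) h2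
    have h5 := congrArg (fun f => s • R.mulVec f) h0
    simp only [Matrix.mulVec_smul, Matrix.smul_mulVec, ← Matrix.mulVec_mulVec] at h3 h4 h5 ⊢
    linear_combination (norm := module) h3 + (b * ∏ j : Fin N, ∏ k ∈ Finset.Ioi j, (z j.succ)⁻¹ *
      (1 + t * z j.succ * z k.succ) * (1 + t * z j.succ * (z k.succ)⁻¹)) • (h4 + h5)

/-- The mirror argument: the leftmost B becomes a field on ⟨1^M|, and this field is carried
rightwards through the other B's. The two exchange factors thus swap roles: at w = -tz_j the factor
that was a numerator becomes part of the Weyl denominator in the variables tz. -/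
theorem vecMul_prod_doubleRowB {M N : ℕ} {t : K} (α γ : ℕ → K) (ht : t ≠ 0) {z : Fin N → K}
    (hz : ∀ k, z k ≠ 0) :
    ((∏ k, t * ((t * z k)⁻¹ - t * z k)) * ∏ j, ∏ k ∈ Finset.Ioi j,
        (z k)⁻¹ * (1 + t * z k * -(t * z j)) * (1 + t * z k * (-(t * z j))⁻¹)) •
        Matrix.vecMul (uniform K M 1) (List.ofFn fun k => doubleRowB M t α γ (z k)).prod =
      ((∏ k, t ^ M * ((z k)⁻¹ + t * z k)) * ∏ j, ∏ k ∈ Finset.Ioi j,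
        (z k + (z k)⁻¹ - -(t * z j) - (-(t * z j))⁻¹)) •
        Matrix.vecMul (uniform K M 1)
          (List.ofFn fun k => field M α γ (-(t * z k))).reverse.prod := by
  induction N with
  | zero => simp
  | succ N ih =>
    have h0 := (uniform_one_vecMul_doubleRow M α γ ht (hz 0)).2.2.2
    rw [← doubleRowB_eq] at h0
    have h1 := ih fun k => hz k.succ
    have h2 := field_mul_prod_doubleRowB (M := M) t α γ (neg_ne_zero.2 (mul_ne_zero ht (hz 0)))
      fun k : Fin N => hz k.succ
    rw [prod_pairs_succ fun j k =>
        (z k)⁻¹ * (1 + t * z k * -(t * z j)) * (1 + t * z k * (-(t * z j))⁻¹),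
      prod_pairs_succ fun j k => z k + (z k)⁻¹ - -(t * z j) - (-(t * z j))⁻¹,
      List.ofFn_succ, List.ofFn_succ, List.reverse_cons, List.prod_append, List.prod_singleton,
      List.prod_cons, Fin.prod_univ_succ, Fin.prod_univ_succ]
    set R := (List.ofFn fun k : Fin N => field M α γ (-(t * z k.succ))).reverse.prod
    set Q := (List.ofFn fun k : Fin N => doubleRowB M t α γ (z k.succ)).prod
    set B := doubleRowB M t α γ (z 0)
    set F := field M α γ (-(t * z 0))
    set s := ∏ k : Fin N, (z k.succ)⁻¹ * (1 + t * z k.succ * -(t * z 0)) *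
      (1 + t * z k.succ * (-(t * z 0))⁻¹)
    set d := ∏ k : Fin N, (z k.succ + (z k.succ)⁻¹ - -(t * z 0) - (-(t * z 0))⁻¹)
    set a := ∏ k : Fin N, t * ((t * z k.succ)⁻¹ - t * z k.succ)
    set e := ∏ j : Fin N, ∏ k ∈ Finset.Ioi j, (z k.succ)⁻¹ * (1 + t * z k.succ * -(t * z j.succ)) *
      (1 + t * z k.succ * (-(t * z j.succ))⁻¹)
    have h3 := congrArg (fun f => (a * e * s) • Matrix.vecMul f Q) h0
    have h4 := congrArg (fun A : Matrix _ _ K => (a * e * (t ^ M * ((z 0)⁻¹ + t * z 0))) •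
      Matrix.vecMul (uniform K M 1) A) h2
    have h5 := congrArg (fun f => (d * (t ^ M * ((z 0)⁻¹ + t * z 0))) • Matrix.vecMul f F) h1
    simp only [Matrix.vecMul_smul, Matrix.smul_vecMul, ← Matrix.vecMul_vecMul] at h3 h4 h5 ⊢
    linear_combination (norm := module) h3 + h4 + h5

/-! ### The type C Weyl denominator formula -/

open Polynomial in
theorem chebyshevS_monic_degree (n : ℕ) :
    ((Chebyshev.S K n).Monic ∧ (Chebyshev.S K n).degree = n) ∧
      (Chebyshev.S K (n + 1)).Monic ∧ (Chebyshev.S K (n + 1)).degree = n + 1 := by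
  induction n with
  | zero => simp
  | succ n ih =>
    obtain ⟨⟨-, h1⟩, h2, h3⟩ := ih
    have hd : (X * Chebyshev.S K (n + 1)).degree = (n : WithBot ℕ) + 1 + 1 := by
      rw [degree_mul, degree_X, h3, add_comm]
    have hlt : (Chebyshev.S K n).degree < (X * Chebyshev.S K (n + 1)).degree := by
      rw [hd, h1]
      norm_cast
      lia
    push_cast
    refine ⟨⟨h2, h3⟩, ?_⟩
    rw [add_assoc (n : ℤ), one_add_one_eq_two, Chebyshev.S_add_two]
    exact ⟨(monic_X.mul h2).sub_of_left hlt, by rw [degree_sub_eq_left_of_degree_lt hlt, hd]⟩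

open Polynomial in
theorem sub_inv_mul_eval_chebyshevS {z : K} (hz : z ≠ 0) (n : ℕ) :
    (z - z⁻¹) * (Chebyshev.S K n).eval (z + z⁻¹) = z ^ (n + 1) - z⁻¹ ^ (n + 1) ∧
      (z - z⁻¹) * (Chebyshev.S K (n + 1)).eval (z + z⁻¹) = z ^ (n + 2) - z⁻¹ ^ (n + 2) := by
  induction n with
  | zero =>
    simp
    ring
  | succ n ih =>
    push_cast
    refine ⟨ih.2, ?_⟩
    rw [add_assoc (n : ℤ), one_add_one_eq_two, Chebyshev.S_add_two, eval_sub, eval_mul, eval_X,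
      mul_sub, mul_left_comm, ih.1, ih.2]
    have h := mul_inv_cancel₀ hz
    generalize z⁻¹ = y at h
    linear_combination (z ^ (n + 1) - y ^ (n + 1)) * h

/-- Dividing column k by z_k - z_k⁻¹ leaves monic Chebyshev polynomials in z_k + z_k⁻¹, hence a
Vandermonde determinant. -/
theorem det_pow_sub_inv_pow {N : ℕ} {z : Fin N → K} (hz : ∀ k, z k ≠ 0) :
    Matrix.det (Matrix.of fun i k : Fin N => z k ^ ((i : ℕ) + 1) - (z k)⁻¹ ^ ((i : ℕ) + 1)) =
      (∏ k, (z k - (z k)⁻¹)) *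
        ∏ i, ∏ j ∈ Finset.Ioi i, (z j + (z j)⁻¹ - (z i + (z i)⁻¹)) := by
  rw [← Matrix.det_vandermonde fun k => z k + (z k)⁻¹,
    Matrix.det_eval_matrixOfPolynomials_eq_det_vandermonde _
      (fun i : Fin N => Polynomial.Chebyshev.S K (i : ℕ))
      (fun i => Polynomial.natDegree_eq_of_degree_eq_some (chebyshevS_monic_degree i).1.2)
      (fun i => (chebyshevS_monic_degree i).1.1), ← Matrix.det_mul_column, ← Matrix.det_transpose]
  congr 1
  ext k i
  exact ((sub_inv_mul_eval_chebyshevS (hz k) i).1).symm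

theorem sign_rev_mul_symplecticDenom {N : ℕ} {z : Fin N → K} (hz : ∀ k, z k ≠ 0) :
    (Equiv.Perm.sign (Fin.revPerm : Equiv.Perm (Fin N)) : K) * symplecticDenom z =
      (∏ k, (z k - (z k)⁻¹)) *
        ∏ i, ∏ j ∈ Finset.Ioi i, (z j + (z j)⁻¹ - (z i + (z i)⁻¹)) := by
  rw [← det_pow_sub_inv_pow hz, symplecticDenom, ← Matrix.det_permute]
  congr 1
  ext i k
  have h : ((N : ℤ) - ((Fin.rev i : Fin N) : ℕ)) = ((i + 1 : ℕ) : ℤ) := by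
    rw [Fin.val_rev]
    omega
  have h' : -(N : ℤ) + ((Fin.rev i : Fin N) : ℕ) = -((i + 1 : ℕ) : ℤ) := by
    rw [← h]
    ring
  simp only [Matrix.submatrix_apply, Matrix.of_apply, id, Fin.revPerm_apply, h, h', zpow_neg,
    zpow_natCast, inv_pow]

theorem prod_pairs_rev {N : ℕ} (f : Fin N → Fin N → K) :
    ∏ i : Fin N, ∏ j ∈ Finset.Ioi i, f j.rev i.rev = ∏ i, ∏ j ∈ Finset.Ioi i, f i j := by
  have h : ∀ g : Fin N → Fin N → K,
      ∏ i, ∏ j ∈ Finset.Ioi i, g i j = ∏ i, ∏ j, if i < j then g i j else 1 := by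
    intro g
    refine Finset.prod_congr rfl fun i _ => ?_
    rw [← Finset.prod_filter]
    refine Finset.prod_congr ?_ fun _ _ => rfl
    ext j
    simp
  rw [h, h, Finset.prod_comm, ← Equiv.prod_comp Fin.revPerm]
  refine Finset.prod_congr rfl fun i _ => ?_
  rw [← Equiv.prod_comp Fin.revPerm]
  simp

/-- Reversing the variables costs the same sign as reversing the rows, so no sign remains for pairs
i < j. -/
theorem symplecticDenom_eq {N : ℕ} {z : Fin N → K} (hz : ∀ k, z k ≠ 0) :
    symplecticDenom z = (∏ k, (z k - (z k)⁻¹)) *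
      ∏ i, ∏ j ∈ Finset.Ioi i, (z i + (z i)⁻¹ - z j - (z j)⁻¹) := by
  have h := sign_rev_mul_symplecticDenom (z := fun k => z k.rev) fun k => hz _
  have hrev : ∏ k : Fin N, (z k.rev - (z k.rev)⁻¹) = ∏ k, (z k - (z k)⁻¹) :=
    Equiv.prod_comp Fin.revPerm fun k => z k - (z k)⁻¹
  rw [prod_pairs_rev fun i j => z i + (z i)⁻¹ - (z j + (z j)⁻¹), hrev] at h
  simp only [sub_sub]
  rw [← h, symplecticDenom, symplecticDenom, ← Matrix.det_permute']
  congr 1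
  ext i k
  simp

/-! ### Bookkeeping of powers, reversals and signs -/

theorem prod_pairs_const_sq_mul {N : ℕ} (t : K) :
    (∏ j : Fin N, ∏ _k ∈ Finset.Ioi j, t) ^ 2 * t ^ N = t ^ (N * N) := by
  induction N with
  | zero => simp
  | succ N ih =>
    rw [prod_pairs_succ fun _ _ => t, show (N + 1) * (N + 1) = N * N + (N + N + 1) by ring,
      pow_add t (N * N), ← ih]
    simp
    ring

theorem prod_inv_add_mul_prod_pairs {N : ℕ} (t : K) {z : Fin N → K} (hz : ∀ k, z k ≠ 0) :
    (∏ k, ((z k)⁻¹ + t * z k)) * ∏ j, ∏ _k ∈ Finset.Ioi j, (z j)⁻¹ =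
      ∏ j : Fin N, z j ^ ((j : ℤ) - (N : ℤ)) * (1 + t * z j ^ 2) := by
  rw [← Finset.prod_mul_distrib]
  refine Finset.prod_congr rfl fun j _ => ?_
  -- z_j⁻¹ occurs once for each of the N - 1 - j indices k > j, and once more in z_j⁻¹ + t z_j.
  have h : (j : ℤ) - (N : ℤ) = -((N - 1 - (j : ℕ) : ℕ) : ℤ) - 1 := by omega
  rw [Finset.prod_const, Fin.card_Ioi, h, zpow_sub_one₀ (hz j), zpow_neg, zpow_natCast, inv_pow]
  have := hz j
  field_simp

theorem reverse_ofFn {X : Type*} {N : ℕ} (f : Fin N → X) :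
    (List.ofFn f).reverse = List.ofFn fun k => f k.rev := by
  refine List.ext_getElem (by simp) fun i h1 h2 => ?_
  simp only [List.getElem_reverse, List.getElem_ofFn, List.length_ofFn]
  congr 1
  ext
  simp [Fin.val_rev]
  lia

theorem gFun_neg (M : ℕ) (α γ : ℕ → K) (μ : ℕ) (w : K) :
    gFun M α γ μ (-w) = (-1) ^ (μ + 1) * gFun M (fun j => -α j) (fun j => -γ j) μ w := by
  have h : ∏ j ∈ Finset.Icc 0 μ, (α j + (1 - α j * γ j) * -w) =
      (-1) ^ (μ + 1) * ∏ j ∈ Finset.Icc 0 μ, (-α j + (1 - -α j * -γ j) * w) := by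
    have : (-1 : K) ^ (μ + 1) = ∏ j ∈ Finset.Icc 0 μ, (-1) := by simp
    rw [this, ← Finset.prod_mul_distrib]
    exact Finset.prod_congr rfl fun j _ => by ring
  rw [gFun, gFun, h]
  simp only [inv_neg, mul_neg, neg_mul, mul_assoc]

/-- The site-dependent part of the sign from w ↦ -w is exactly the Jordan-Wigner sign of a hole at
site k, leaving a uniform -1. -/
theorem amplitude_neg (M : ℕ) (α γ : ℕ → K) (w : K) (k : Fin M) :
    (-1) ^ (k : ℕ) * amplitude M α γ (-w) k =
      -amplitude M (fun j => -α j) (fun j => -γ j) w k := by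
  have h : (-1 : K) ^ (k : ℕ) * (-1) ^ (k : ℕ) = 1 := by
    rw [← mul_pow]
    simp
  rw [amplitude, amplitude, inv_neg, gFun_neg, gFun_neg, pow_succ]
  linear_combination (-(gFun M (fun j => -α j) (fun j => -γ j) k w -
    gFun M (fun j => -α j) (fun j => -γ j) k w⁻¹)) * h

theorem mulVec_uniform {M : ℕ} (A : Matrix (Fin M → Fin 2) (Fin M → Fin 2) K) (s : Fin 2)
    (p : Fin M → Fin 2) : A.mulVec (uniform K M s) p = A p fun _ => s := by
  simp [uniform]

theorem uniform_vecMul {M : ℕ} (A : Matrix (Fin M → Fin 2) (Fin M → Fin 2) K) (s : Fin 2)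
    (p : Fin M → Fin 2) : Matrix.vecMul (uniform K M s) A p = A (fun _ => s) p := by
  simp [uniform]

/-! ### Assembling both formulas -/

section Main

variable {M N : ℕ} {z : Fin N → K} {x : Fin N → ℕ} {y : Fin N → Fin M}

theorem particles_eq_configAt (hxy : ∀ i, x i = y i + 1) :
    particles M x = configAt 1 0 y := by
  funext k
  simp [particles, configAt, hxy, Fin.ext_iff]

theorem holes_eq_configAt (hxy : ∀ i, x i = y i + 1) :
    holes M x = configAt 0 1 y := by
  funext k
  simp [holes, configAt, hxy, Fin.ext_iff]

theorem symplecticDenom_mul_waveI (t : K) (α γ : ℕ → K) (hz : ∀ k, z k ≠ 0)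
    (hxy : ∀ i, x i = y i + 1) (hy : StrictMono y) :
    symplecticDenom z * waveI M t α γ z x =
      prefactor t z * GDet M α γ (fun j => y j.rev) z := by
  have h := congrFun (prod_doubleRowB_mulVec (M := M) t α γ hz) (configAt 1 0 y)
  have hG : Matrix.det (Matrix.of fun i k => amplitude M α γ (z k.rev) (y i)) =
      GDet M α γ (fun j => y j.rev) z := by
    rw [GDet, ← Matrix.det_submatrix_equiv_self Fin.revPerm]
    congr 1
    ext i k
    simp [amplitude]
  rw [← symplecticDenom_eq hz, reverse_ofFn, Pi.smul_apply, Pi.smul_apply, smul_eq_mul,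
    smul_eq_mul, mulVec_uniform] at h
  rw [waveI, particles_eq_configAt hxy, h, ← hG]
  simp only [field]
  rw [prod_creation_mulVec _ hy, prefactor, ← prod_inv_add_mul_prod_pairs t hz]
  congr 1
  simp only [mul_assoc, Finset.prod_mul_distrib]

theorem symplecticDenom_mul_dualWaveI {t : K} (α γ : ℕ → K) (ht : t ≠ 0) (hz : ∀ k, z k ≠ 0)
    (hxy : ∀ i, x i = y i + 1) (hy : StrictMono y) :
    symplecticDenom (fun k => t * z k) * dualWaveI M t α γ z x =
      t ^ (N * (M - N)) * prefactor t z *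
        GDet M (fun j => -α j) (fun j => -γ j) (fun j => y j.rev) fun k => t * z k := by
  have h := congrFun (vecMul_prod_doubleRowB (M := M) α γ ht hz) (configAt 0 1 y)
  have hMN : N ≤ M := by simpa using Fintype.card_le_of_injective y hy.injective
  have hz' : ∀ k, t * z k ≠ 0 := fun k => mul_ne_zero ht (hz k)
  have hG : Matrix.det (Matrix.of fun i k =>
      (-1) ^ (y i : ℕ) * amplitude M α γ (-(t * z k)) (y i)) =
      (-1) ^ N * ((Equiv.Perm.sign (Fin.revPerm : Equiv.Perm (Fin N)) : K) *
        GDet M (fun j => -α j) (fun j => -γ j) (fun j => y j.rev) fun k => t * z k) := by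
    rw [GDet, ← Matrix.det_permute]
    simp only [amplitude_neg]
    have := Matrix.det_neg (Matrix.of fun (i k : Fin N) =>
      amplitude M (fun j => -α j) (fun j => -γ j) (t * z k) (y i))
    rw [Fintype.card_fin] at this
    rw [show (Matrix.of fun (i k : Fin N) =>
      -amplitude M (fun j => -α j) (fun j => -γ j) (t * z k) (y i)) = -(Matrix.of fun (i k : Fin N) =>
      amplitude M (fun j => -α j) (fun j => -γ j) (t * z k) (y i)) from rfl, this]
    congr 2
    ext i k
    simp [amplitude]
  have hD : (∏ k, t * ((t * z k)⁻¹ - t * z k)) * (∏ j, ∏ k ∈ Finset.Ioi j,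
        (z k)⁻¹ * (1 + t * z k * -(t * z j)) * (1 + t * z k * (-(t * z j))⁻¹)) =
      (-1) ^ N * (t ^ N * (∏ j : Fin N, ∏ _k ∈ Finset.Ioi j, t)) *
        ((Equiv.Perm.sign (Fin.revPerm : Equiv.Perm (Fin N)) : K) *
          symplecticDenom fun k => t * z k) := by
    rw [sign_rev_mul_symplecticDenom hz']
    have h1 : ∏ k, t * ((t * z k)⁻¹ - t * z k) =
        (-1) ^ N * t ^ N * ∏ k, (t * z k - (t * z k)⁻¹) := by
      rw [← mul_pow, ← Fin.prod_const, ← Finset.prod_mul_distrib]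
      exact Finset.prod_congr rfl fun k _ => by ring
    have h2 : ∏ j, ∏ k ∈ Finset.Ioi j,
        (z k)⁻¹ * (1 + t * z k * -(t * z j)) * (1 + t * z k * (-(t * z j))⁻¹) =
        (∏ j : Fin N, ∏ _k ∈ Finset.Ioi j, t) * ∏ i, ∏ j ∈ Finset.Ioi i,
          (t * z j + (t * z j)⁻¹ - (t * z i + (t * z i)⁻¹)) := by
      simp only [← Finset.prod_mul_distrib]
      refine Finset.prod_congr rfl fun j _ => Finset.prod_congr rfl fun k _ => ?_
      have := hz j
      have := hz k
      rw [inv_neg]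
      field_simp
      ring
    rw [h1, h2]
    ring
  have hE : (∏ k, t ^ M * ((z k)⁻¹ + t * z k)) * (∏ j, ∏ k ∈ Finset.Ioi j,
        (z k + (z k)⁻¹ - -(t * z j) - (-(t * z j))⁻¹)) *
        ∏ j : Fin N, ∏ _k ∈ Finset.Ioi j, t =
      t ^ (M * N) * prefactor t z := by
    rw [prefactor, ← prod_inv_add_mul_prod_pairs t hz, Finset.prod_mul_distrib, Fin.prod_const,
      ← pow_mul, mul_assoc, mul_assoc, mul_assoc]
    congr 2
    simp only [← Finset.prod_mul_distrib]
    refine Finset.prod_congr rfl fun j _ => Finset.prod_congr rfl fun k _ => ?_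
    have := hz j
    have := hz k
    rw [inv_neg]
    field_simp
    ring
  rw [Pi.smul_apply, Pi.smul_apply, smul_eq_mul, smul_eq_mul, uniform_vecMul, hD] at h
  simp only [field] at h
  rw [vecMul_prod_creation _ hy, hG] at h
  set T := ∏ j : Fin N, ∏ _k ∈ Finset.Ioi j, t with hT
  have hT0 : T ≠ 0 := Finset.prod_ne_zero_iff.2 fun j _ => Finset.prod_ne_zero_iff.2 fun _ _ => ht
  have hs : (Equiv.Perm.sign (Fin.revPerm : Equiv.Perm (Fin N)) : K) ≠ 0 := by
    rcases Int.units_eq_one_or (Equiv.Perm.sign (Fin.revPerm : Equiv.Perm (Fin N))) with h | h <;>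
      simp [h]
  -- Each conversion on ⟨1^M| yields t^M. Clearing t from the pair factors on both sides uses up T²,
  -- and the single factors use up t^N. What is left is t^(N(M-N)).
  have hpow : t ^ (M * N) = T ^ 2 * t ^ N * t ^ (N * (M - N)) := by
    rw [prod_pairs_const_sq_mul, ← pow_add, ← mul_add, Nat.add_sub_cancel' hMN, mul_comm]
  rw [hpow] at hE
  rw [dualWaveI, holes_eq_configAt hxy]
  have hc : (-1 : K) ^ N * (t ^ N * T ^ 2) *
      (Equiv.Perm.sign (Fin.revPerm : Equiv.Perm (Fin N)) : K) ≠ 0 := by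
    simp [ht, hT0, hs]
  refine mul_left_cancel₀ hc ?_
  linear_combination T * h + ((-1) ^ N * (Equiv.Perm.sign (Fin.revPerm : Equiv.Perm (Fin N)) : K) *
    GDet M (fun j => -α j) (fun j => -γ j) (fun j => y j.rev) fun k => t * z k) * hE

end Main

end FreeFermion

theorem mainTheorem1 (M N : ℕ) (t : ℂ) (α γ : ℕ → ℂ) (z : Fin N → ℂ) (hz : ∀ j, z j ≠ 0)
    (x : Fin N → ℕ) (hx : StrictMono x) (hxM : ∀ j, 1 ≤ x j ∧ x j ≤ M)
    (lam : Fin N → ℕ)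
    (hlam : ∀ j : Fin N, (lam j : ℤ) = (x j.rev : ℤ) - (N : ℤ) + (j : ℤ)) :
    (FreeFermion.symplecticDenom z ≠ 0 →
      FreeFermion.waveI M t α γ z x =
        FreeFermion.prefactor t z * FreeFermion.spSchur M α γ lam z) ∧
    (t ≠ 0 → FreeFermion.symplecticDenom (fun j => t * z j) ≠ 0 →
      FreeFermion.dualWaveI M t α γ z x =
        t ^ (N * (M - N)) * FreeFermion.prefactor t z *
          FreeFermion.spSchur M (fun j => -α j) (fun j => -γ j) lam (fun j => t * z j)) := by
  obtain ⟨y, hxy⟩ : ∃ y : Fin N → Fin M, ∀ i, x i = y i + 1 :=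
    ⟨fun i => ⟨x i - 1, by have := hxM i; omega⟩, fun i => by have := hxM i; simp; omega⟩
  have hy : StrictMono y := by
    intro i j hij
    have h := hx hij
    rw [hxy, hxy] at h
    exact Fin.lt_def.2 (by omega)
  -- The shifted parts μ_j are the zero-based positions in decreasing order.
  have hμ : (fun j : Fin N => lam j + (N - 1 - (j : ℕ))) = fun j => (y j.rev : ℕ) := by
    funext j
    have h := hlam j
    rw [hxy] at h
    omega
  refine ⟨fun hD => ?_, fun ht hD => ?_⟩
  · rw [FreeFermion.spSchur, hμ, ← mul_div_assoc, eq_div_iff hD, mul_comm]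
    exact FreeFermion.symplecticDenom_mul_waveI t α γ hz hxy hy
  · rw [FreeFermion.spSchur, hμ, ← mul_div_assoc, eq_div_iff hD, mul_comm]
    exact FreeFermion.symplecticDenom_mul_dualWaveI α γ ht hz hxy hy
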